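/- Let $K$ be a commutative ring and let $A$ be a dg $K$-algebra with enough idempotents: a possibly non-unital, $\mathbb{Z}$-graded associative $K$-algebra with a $K$-linear differential $d$ of degree $+1$ ($d^2=0$ and $d(ab)=d(a)b+(-1)^{|a|}a\,d(b)$) and with a family $(e_i)_{i\in I}$ of nonzero orthogonal idempotents of degree $0$ such that $d(e_i)=0$ and $A=\bigoplus_i e_iA=\bigoplus_i Ae_i$. Right $A$-modules $M$ are assumed unitary, i.e. $MA=M$. Let $Dg\text{-}A$ be the dg category of right dg $A$-modules: $\mathrm{HOM}_A^n(M,N)$ is the $K$-module of $A$-linear maps $f$ with $f(M^k)\subseteq N^{k+n}$ for all $k$, and $d(f)=d_N\circ f-(-1)^{n} f\circ d_M$. Let $\mathcal{C}(A)=Z^0(Dg\text{-}A)$ be its $0$-cycle category and $H^0(Dg\text{-}A)$ its $0$-homology category. The shift $?[1]$ is given by $M[1]^k=M^{k+1}$, with the same $A$-action, and $d_{M[1]}=-d_M$. The cone of a morphism $f:M\to N$ of $\mathcal{C}(A)$ is $C(f)=N\oplus M[1]$ with differential $\begin{pmatrix} d_N & f\\ 0& d_{M[1]}\end{pmatrix}$.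 Call conflations those sequences $0\to L\to M\to N\to 0$ in $\mathcal{C}(A)$ which are split short exact in the category $Gr\text{-}A$ of graded right $A$-modules (the semi-split exact structure). Then: 1. With these conflations, $\mathcal{C}(A)$ is a Frobenius exact category: a Quillen exact category with enough projectives and enough injectives, whose projectives and injectives coincide. For each $M$ there is a conflation $0\to M\to C(1_M)\to M[1]\to 0$, given by the canonical inclusion and projection, in which $C(1_M)$ is injective. 2. Let $\mathcal{H}(A)$ be the stable category of this Frobenius category: it has the same objects as $\mathcal{C}(A)$, and its morphisms are those of $\mathcal{C}(A)$ modulo the ones that factor through a projective (equivalently, injective) object. Then $\mathcal{H}(A)$ is a $K$-linear triangulated category with arbitrary (set-indexed) coproducts, whose suspension functor is induced by the shift $?[1]$ and whose distinguished triangles are, up to isomorphism, the images of the conflations $0\to L\xrightarrow{u} M\xrightarrow{v} N\to 0$ of $\mathcal{C}(A)$. Precisely, they are the triangles isomorphic in $\mathcal{H}(A)$ to the image of some $L\xrightarrow{u}M\xrightarrow{v}N\xrightarrow{-w}L[1]$, where $(u,v)$ is a conflation and $w:N\to L[1]$ is a morphism of $\mathcal{C}(A)$ for which there is a morphism $g:M\to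 C(1_L)$ of $\mathcal{C}(A)$ such that $g\circ u:L\to C(1_L)$ is the canonical inclusion and $w\circ v$ is the composite of $g$ with the canonical projection $C(1_L)\to L[1]$. 3. There is a $K$-linear equivalence of categories $\mathcal{H}(A)\simeq H^0(Dg\text{-}A)$ which is compatible, up to natural isomorphism, with the projection functors from $\mathcal{C}(A)=Z^0(Dg\text{-}A)$. -/

import Mathlib

open CategoryTheory CategoryTheory.Limits

universe u v w v' u'

/-! ### Dg categories, 0-cycle category and 0-homology category -/

/-- A dg category over `K`: the `K`-module of morphisms is `⨁ n, Hom X Y n`, with a differential of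
degree `1` and a `K`-bilinear composition of degree `0`. We write `comp f g` for `g ∘ f`. Degrees are
constrained by equations, such as `h : p + q = r`, in order to avoid casts. -/
class DGCategory (K : Type u) [CommRing K] (C : Type u') where
  Hom : C → C → ℤ → Type v'
  [addCommGroup : ∀ X Y n, AddCommGroup (Hom X Y n)]
  [module : ∀ X Y n, Module K (Hom X Y n)]
  d : ∀ {X Y : C} (n m : ℤ), n + 1 = m → (Hom X Y n →ₗ[K] Hom X Y m)
  id : ∀ X : C, Hom X X 0
  comp : ∀ {X Y Z : C} (p q r : ℤ), p + q = r →
    (Hom X Y p →ₗ[K] Hom Y Z q →ₗ[K] Hom X Z r)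
  d_d : ∀ {X Y : C} (n m l : ℤ) (h : n + 1 = m) (h' : m + 1 = l) (f : Hom X Y n),
    d m l h' (d n m h f) = 0
  id_comp : ∀ {X Y : C} (p : ℤ) (h : 0 + p = p) (f : Hom X Y p), comp 0 p p h (id X) f = f
  comp_id : ∀ {X Y : C} (p : ℤ) (h : p + 0 = p) (f : Hom X Y p), comp p 0 p h f (id Y) = f
  assoc : ∀ {X Y Z W : C} (p q r pq qr pqr : ℤ) (h₁ : p + q = pq) (h₂ : q + r = qr)
    (h₃ : pq + r = pqr) (h₄ : p + qr = pqr) (f : Hom X Y p) (g : Hom Y Z q) (k : Hom Z W r),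
    comp pq r pqr h₃ (comp p q pq h₁ f g) k = comp p qr pqr h₄ f (comp q r qr h₂ g k)
  leibniz : ∀ {X Y Z : C} (p q r p' q' r' : ℤ) (h : p + q = r) (hp : p + 1 = p')
    (hq : q + 1 = q') (hr : r + 1 = r') (h₁ : p + q' = r') (h₂ : p' + q = r')
    (f : Hom X Y p) (g : Hom Y Z q),
    d r r' hr (comp p q r h f g) =
      comp p q' r' h₁ f (d q q' hq g) + q.negOnePow • comp p' q r' h₂ (d p p' hp f) g

attribute [reducible, instance] DGCategory.addCommGroup DGCategory.module

namespace DGCategory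

variable (K : Type u) [CommRing K] (C : Type u') [DGCategory.{u, v', u'} K C]

variable {C} in
lemma d_id (X : C) : d (K := K) 0 1 (zero_add 1) (id (K := K) X) = 0 := by
  have h := leibniz (K := K) 0 0 0 1 1 1 (zero_add 0) (zero_add 1) (zero_add 1) (zero_add 1)
    (zero_add 1) (add_zero 1) (id (K := K) X) (id (K := K) X)
  rw [id_comp, id_comp, comp_id, Int.negOnePow_zero, one_smul] at h
  simpa using h

/-- The `K`-module `Z⁰(Hom(X, Y))` of `0`-cycles. -/
abbrev zeroCycles {C : Type u'} [DGCategory.{u, v', u'} K C] (X Y : C) :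
    Submodule K (Hom K X Y 0) :=
  LinearMap.ker (d (K := K) (X := X) (Y := Y) 0 1 (zero_add 1))

/-- The `0`-cycle category `Z⁰ C`: same objects as `C`, the morphisms are the `0`-cycles. -/
structure ZeroCycle (K : Type u) [CommRing K] (C : Type u') [DGCategory.{u, v', u'} K C] where
  of (K) ::
  as : C

instance : Category.{v'} (ZeroCycle K C) where
  Hom X Y := zeroCycles K X.as Y.as
  id X := ⟨id (K := K) X.as, d_id K X.as⟩
  comp f g := ⟨comp 0 0 0 (zero_add 0) f.1 g.1, by
    have hf := f.2
    have hg := g.2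
    rw [LinearMap.mem_ker] at hf hg ⊢
    rw [leibniz 0 0 0 1 1 1 (zero_add 0) (zero_add 1) (zero_add 1) (zero_add 1)
      (zero_add 1) (add_zero 1), hf, hg]
    simp⟩
  id_comp f := Subtype.ext (id_comp 0 _ f.1)
  comp_id f := Subtype.ext (comp_id 0 _ f.1)
  assoc f g k := Subtype.ext (assoc 0 0 0 0 0 0 _ _ _ _ f.1 g.1 k.1)

instance : Preadditive (ZeroCycle K C) where
  homGroup X Y := inferInstanceAs (AddCommGroup (zeroCycles K X.as Y.as))
  add_comp _ _ _ f f' g := Subtype.ext <|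
    (LinearMap.congr_fun (map_add (comp 0 0 0 (zero_add 0)) f.1 f'.1) g.1 :)
  comp_add _ _ _ f g g' := Subtype.ext (map_add (comp 0 0 0 (zero_add 0) f.1) g.1 g'.1)

instance : Linear K (ZeroCycle K C) where
  homModule X Y := inferInstanceAs (Module K (zeroCycles K X.as Y.as))
  smul_comp _ _ _ c f g := Subtype.ext <|
    (LinearMap.congr_fun (map_smul (comp 0 0 0 (zero_add 0)) c f.1) g.1 :)
  comp_smul _ _ _ f c g := Subtype.ext (map_smul (comp 0 0 0 (zero_add 0) f.1) c g.1)

variable {K C} in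
/-- The degree `0` element of the dg category underlying a morphism of the `0`-cycle category. -/
def ZeroCycle.val {X Y : ZeroCycle K C} (f : X ⟶ Y) : Hom K X.as Y.as 0 :=
  (show zeroCycles K X.as Y.as from f).1

variable {K C} in
lemma ZeroCycle.d_val {X Y : ZeroCycle K C} (f : X ⟶ Y) : d 0 1 (zero_add 1) (val f) = 0 :=
  (show zeroCycles K X.as Y.as from f).2

/-- Two `0`-cycles are related if they differ by a `0`-boundary, i.e. by an element of
`B⁰(Hom(X, Y)) = d(Hom⁻¹(X, Y))`. -/
def boundaryRel : HomRel (ZeroCycle K C) := fun X Y f g =>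
  ∃ σ : Hom K X.as Y.as (-1),
    ZeroCycle.val f - ZeroCycle.val g = d (-1) 0 (neg_add_cancel 1) σ

instance : Congruence (boundaryRel K C) where
  equivalence {X Y} :=
    { refl := fun f => ⟨0, by simp⟩
      symm := by
        rintro f g ⟨σ, h⟩
        exact ⟨-σ, by rw [map_neg, ← h, neg_sub]⟩
      trans := by
        rintro f g k ⟨σ, h⟩ ⟨τ, h'⟩
        exact ⟨σ + τ, by rw [map_add, ← h, ← h', sub_add_sub_cancel]⟩ }
  comp_left {X Y Z} f g g' := by
    rintro ⟨σ, h⟩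
    refine ⟨comp 0 (-1) (-1) (zero_add _) (ZeroCycle.val f) σ, ?_⟩
    rw [leibniz 0 (-1) (-1) 1 0 0 (zero_add _) (zero_add 1) (neg_add_cancel 1)
      (neg_add_cancel 1) (zero_add 0) (add_neg_cancel 1), ZeroCycle.d_val f, ← h]
    simp only [map_zero, LinearMap.zero_apply, smul_zero, add_zero, map_sub]
    rfl
  comp_right {X Y Z} f f' g := by
    rintro ⟨σ, h⟩
    refine ⟨comp (-1) 0 (-1) (add_zero _) σ (ZeroCycle.val g), ?_⟩
    rw [leibniz (-1) 0 (-1) 0 1 0 (add_zero _) (neg_add_cancel 1) (zero_add 1)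
      (neg_add_cancel 1) (neg_add_cancel 1) (zero_add 0), ZeroCycle.d_val g, ← h]
    simp only [map_zero, zero_add, map_sub, Int.negOnePow_zero, one_smul, LinearMap.sub_apply]
    rfl

lemma boundaryRel_add ⦃X Y : ZeroCycle K C⦄ (f₁ f₂ g₁ g₂ : X ⟶ Y) (hf : boundaryRel K C f₁ f₂)
    (hg : boundaryRel K C g₁ g₂) : boundaryRel K C (f₁ + g₁) (f₂ + g₂) := by
  obtain ⟨σ, h⟩ := hf
  obtain ⟨τ, h'⟩ := hg
  exact ⟨σ + τ, by rw [map_add, ← h, ← h']; exact add_sub_add_comm _ _ _ _⟩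

lemma boundaryRel_smul (c : K) ⦃X Y : ZeroCycle K C⦄ (f g : X ⟶ Y) (hf : boundaryRel K C f g) :
    boundaryRel K C (c • f) (c • g) := by
  obtain ⟨σ, h⟩ := hf
  exact ⟨c • σ, by rw [map_smul, ← h]; exact (smul_sub c _ _).symm⟩

/-- The `0`-homology category `H⁰ C`: same objects as `C`, the morphisms are
`H⁰(Hom(X, Y)) = Z⁰(Hom(X, Y)) / B⁰(Hom(X, Y))`. -/
def ZeroHomology : Type u' := Quotient (boundaryRel K C)

instance : Category.{v'} (ZeroHomology K C) :=
  inferInstanceAs (Category (Quotient (boundaryRel K C)))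

/-- The projection functor `Z⁰ C ⥤ H⁰ C`. -/
def toZeroHomology : ZeroCycle K C ⥤ ZeroHomology K C := Quotient.functor (boundaryRel K C)

instance : Preadditive (ZeroHomology K C) := Quotient.preadditive _ (boundaryRel_add K C)

instance : (toZeroHomology K C).Additive := Quotient.functor_additive _ (boundaryRel_add K C)

instance : Linear K (ZeroHomology K C) :=
  letI : Preadditive (Quotient (boundaryRel K C)) := Quotient.preadditive _ (boundaryRel_add K C)
  haveI : (Quotient.functor (boundaryRel K C)).Additive :=
    Quotient.functor_additive _ (boundaryRel_add K C)
  Quotient.linear K (boundaryRel K C) (boundaryRel_smul K C)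

end DGCategory

/-! ### Exact categories, Frobenius categories, stable categories -/

section Exact

variable {C : Type u'} [Category.{v'} C] [Preadditive C]

/-- An inflation (admissible monomorphism) for a class `E` of short complexes. -/
def IsInflation (E : ObjectProperty (ShortComplex C)) {X Y : C} (i : X ⟶ Y) : Prop :=
  ∃ (Z : C) (p : Y ⟶ Z) (h : i ≫ p = 0), E (ShortComplex.mk i p h)

/-- A deflation (admissible epimorphism) for a class `E` of short complexes. -/
def IsDeflation (E : ObjectProperty (ShortComplex C)) {Y Z : C} (p : Y ⟶ Z) : Prop :=
  ∃ (X : C) (i : X ⟶ Y) (h : i ≫ p = 0), E (ShortComplex.mk i p h)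

/-- `E` is the class of conflations of a Quillen exact structure on the additive category `C`. -/
structure IsExactStructure (E : ObjectProperty (ShortComplex C)) : Prop where
  hasFiniteBiproducts : HasFiniteBiproducts C
  closedUnderIso : E.IsClosedUnderIsomorphisms
  isKernel : ∀ S, E S → Nonempty (IsLimit (KernelFork.ofι S.f S.zero))
  isCokernel : ∀ S, E S → Nonempty (IsColimit (CokernelCofork.ofπ S.g S.zero))
  inflation_id : ∀ X : C, IsInflation E (𝟙 X)
  deflation_id : ∀ X : C, IsDeflation E (𝟙 X)
  inflation_comp : ∀ {X Y Z : C} (i : X ⟶ Y) (j : Y ⟶ Z),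
    IsInflation E i → IsInflation E j → IsInflation E (i ≫ j)
  deflation_comp : ∀ {X Y Z : C} (p : X ⟶ Y) (q : Y ⟶ Z),
    IsDeflation E p → IsDeflation E q → IsDeflation E (p ≫ q)
  pushout : ∀ {X Y X' : C} (i : X ⟶ Y) (f : X ⟶ X'), IsInflation E i →
    ∃ (Y' : C) (f' : Y ⟶ Y') (i' : X' ⟶ Y'), IsPushout i f f' i' ∧ IsInflation E i'
  pullback : ∀ {Y Z Z' : C} (p : Y ⟶ Z) (f : Z' ⟶ Z), IsDeflation E p →
    ∃ (Y' : C) (f' : Y' ⟶ Y) (p' : Y' ⟶ Z'), IsPullback f' p' p f ∧ IsDeflation E p'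

/-- `P` is projective with respect to the conflations in `E`. -/
def IsRelProjective (E : ObjectProperty (ShortComplex C)) (P : C) : Prop :=
  ∀ S, E S → ∀ f : P ⟶ S.X₃, ∃ g : P ⟶ S.X₂, g ≫ S.g = f

/-- `I` is injective with respect to the conflations in `E`. -/
def IsRelInjective (E : ObjectProperty (ShortComplex C)) (I : C) : Prop :=
  ∀ S, E S → ∀ f : S.X₁ ⟶ I, ∃ g : S.X₂ ⟶ I, S.f ≫ g = f

/-- `C`, with the conflations in `E`, is a Frobenius exact category: it is an exact category with
enough projectives and enough injectives, in which projectives and injectives coincide. -/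
structure IsFrobeniusExact (E : ObjectProperty (ShortComplex C)) : Prop
    extends IsExactStructure E where
  enoughProjectives : ∀ X : C, ∃ (P : C) (p : P ⟶ X), IsRelProjective E P ∧ IsDeflation E p
  enoughInjectives : ∀ X : C, ∃ (I : C) (i : X ⟶ I), IsRelInjective E I ∧ IsInflation E i
  projective_iff_injective : ∀ X : C, IsRelProjective E X ↔ IsRelInjective E X

/-- Two morphisms are stably equal if their difference factors through a projective object
(with respect to `E`; in a Frobenius exact category, projective is the same as injective). -/
def stableRel (E : ObjectProperty (ShortComplex C)) : HomRel C := fun X Y f g =>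
  ∃ (P : C) (a : X ⟶ P) (b : P ⟶ Y), IsRelProjective E P ∧ f - g = a ≫ b

variable (E : ObjectProperty (ShortComplex C))

lemma stableRel_smul {K : Type u} [CommRing K] [Linear K C] (c : K) ⦃X Y : C⦄ (f g : X ⟶ Y)
    (hf : stableRel E f g) : stableRel E (c • f) (c • g) := by
  obtain ⟨P, a, b, hP, h⟩ := hf
  exact ⟨P, c • a, b, hP, by rw [Linear.smul_comp, ← h, smul_sub]⟩

variable [HasBinaryBiproducts C]

lemma IsRelProjective.biprod {P Q : C} (hP : IsRelProjective E P) (hQ : IsRelProjective E Q) :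
    IsRelProjective E (P ⊞ Q) := fun S hS f => by
  obtain ⟨a, ha⟩ := hP S hS (biprod.inl ≫ f)
  obtain ⟨b, hb⟩ := hQ S hS (biprod.inr ≫ f)
  exact ⟨biprod.desc a b, by ext <;> simp [ha, hb]⟩

lemma stableRel_add ⦃X Y : C⦄ (f₁ f₂ g₁ g₂ : X ⟶ Y) (hf : stableRel E f₁ f₂)
    (hg : stableRel E g₁ g₂) : stableRel E (f₁ + g₁) (f₂ + g₂) := by
  obtain ⟨P, a, b, hP, h⟩ := hf
  obtain ⟨Q, c, d, hQ, h'⟩ := hg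
  exact ⟨P ⊞ Q, biprod.lift a c, biprod.desc b d, hP.biprod E hQ, by
    rw [biprod.lift_desc, ← h, ← h']; abel⟩

variable [HasZeroObject C]

open ZeroObject in
instance : Congruence (stableRel E) where
  equivalence {X Y} :=
    { refl := fun f => ⟨0, 0, 0, fun S _ f => ⟨0, (isZero_zero C).eq_of_src _ _⟩, by simp⟩
      symm := by
        rintro f g ⟨P, a, b, hP, h⟩
        exact ⟨P, -a, b, hP, by rw [Preadditive.neg_comp, ← h, neg_sub]⟩
      trans := by
        rintro f g k ⟨P, a, b, hP, h⟩ ⟨Q, c, d, hQ, h'⟩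
        exact ⟨P ⊞ Q, biprod.lift a c, biprod.desc b d, hP.biprod E hQ, by
          rw [biprod.lift_desc, ← h, ← h', sub_add_sub_cancel]⟩ }
  comp_left {X Y Z} f g g' := by
    rintro ⟨P, a, b, hP, h⟩
    exact ⟨P, f ≫ a, b, hP, by rw [← Preadditive.comp_sub, h, Category.assoc]⟩
  comp_right {X Y Z} f f' g := by
    rintro ⟨P, a, b, hP, h⟩
    exact ⟨P, a, b ≫ g, hP, by rw [← Preadditive.sub_comp, h, Category.assoc]⟩

/-- The stable category: same objects as `C`, morphisms of `C` modulo those which factor through a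
projective object. -/
def StableCategory {C : Type u'} [Category.{v'} C] [Preadditive C]
    (E : ObjectProperty (ShortComplex C)) : Type u' := Quotient (stableRel E)

namespace StableCategory

instance : Category.{v'} (StableCategory E) := inferInstanceAs (Category (Quotient (stableRel E)))

/-- The projection functor to the stable category. -/
def proj {C : Type u'} [Category.{v'} C] [Preadditive C]
    (E : ObjectProperty (ShortComplex C)) [HasZeroObject C] [HasBinaryBiproducts C] :
    C ⥤ StableCategory E := Quotient.functor (stableRel E)

instance : Preadditive (StableCategory E) := Quotient.preadditive _ (stableRel_add E)

instance : (proj E).Additive := Quotient.functor_additive _ (stableRel_add E)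

instance {K : Type u} [CommRing K] [Linear K C] : Linear K (StableCategory E) :=
  letI : Preadditive (Quotient (stableRel E)) := Quotient.preadditive _ (stableRel_add E)
  haveI : (Quotient.functor (stableRel E)).Additive := Quotient.functor_additive _ (stableRel_add E)
  Quotient.linear K (stableRel E) (stableRel_smul E)

open ZeroObject in
instance : HasZeroObject (StableCategory E) :=
  ⟨(proj E).obj 0, by rw [IsZero.iff_id_eq_zero, ← (proj E).map_id, id_zero, Functor.map_zero]⟩

variable [HasShift C ℤ] [(stableRel E).IsCompatibleWithShift ℤ]

noncomputable instance : HasShift (StableCategory E) ℤ :=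
  inferInstanceAs (HasShift (Quotient (stableRel E)) ℤ)

noncomputable instance : (proj E).CommShift ℤ := Quotient.functor_commShift (stableRel E) ℤ

instance [∀ n : ℤ, (shiftFunctor C n).Additive] (n : ℤ) :
    (shiftFunctor (StableCategory E) n).Additive := by
  have : (proj E).Full := Quotient.full_functor (stableRel E)
  have : (proj E).EssSurj := Quotient.essSurj_functor (stableRel E)
  have : (proj E ⋙ shiftFunctor (StableCategory E) n).Additive :=
    Functor.additive_of_iso ((proj E).commShiftIso n)
  exact Functor.additive_of_full_essSurj_comp (proj E) _

end StableCategory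

end Exact

/-! ### Dg algebras with enough idempotents and their right dg modules -/

/-- A dg algebra with enough idempotents over `K`. -/
structure DGAlg (K : Type u) [CommRing K] where
  carrier : Type v
  [ring : NonUnitalRing carrier]
  [module : Module K carrier]
  [isScalarTower : IsScalarTower K carrier carrier]
  [smulCommClass : SMulCommClass K carrier carrier]
  gr : ℤ → Submodule K carrier
  isInternal : DirectSum.IsInternal gr
  mul_mem : ∀ {p q : ℤ} {a b : carrier}, a ∈ gr p → b ∈ gr q → a * b ∈ gr (p + q)
  d : carrier →ₗ[K] carrier
  d_mem : ∀ {p : ℤ} {a : carrier}, a ∈ gr p → d a ∈ gr (p + 1)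
  d_d : ∀ a, d (d a) = 0
  leibniz : ∀ {p : ℤ} {a : carrier} (b : carrier), a ∈ gr p →
    d (a * b) = d a * b + p.negOnePow • (a * d b)
  /-- There is a distinguished family of nonzero orthogonal idempotents of degree `0`, killed by the
  differential, such that `A = ⨁ eᵢA = ⨁ Aeᵢ`. -/
  enough_idempotents : ∃ (I : Type v) (e : I → carrier),
    (∀ i, e i ≠ 0) ∧ (∀ i, e i * e i = e i) ∧ (∀ i j, i ≠ j → e i * e j = 0) ∧
    (∀ i, e i ∈ gr 0) ∧ (∀ i, d (e i) = 0) ∧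
    (iSupIndep (fun i => LinearMap.range (LinearMap.mulLeft K (e i))) ∧
      ⨆ i, LinearMap.range (LinearMap.mulLeft K (e i)) = ⊤) ∧
    (iSupIndep (fun i => LinearMap.range (LinearMap.mulRight K (e i))) ∧
      ⨆ i, LinearMap.range (LinearMap.mulRight K (e i)) = ⊤)

attribute [instance] DGAlg.ring DGAlg.module DGAlg.isScalarTower DGAlg.smulCommClass

section Modules

variable {K : Type u} [CommRing K]

/-- A (unitary) graded right `A`-module; `act x a` is `x a`. -/
structure GrMod (A : DGAlg.{u, v} K) where
  carrier : Type w
  [addCommGroup : AddCommGroup carrier]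
  [module : Module K carrier]
  act : carrier →ₗ[K] A.carrier →ₗ[K] carrier
  act_act : ∀ x a b, act (act x a) b = act x (a * b)
  /-- `M A = M` -/
  unitary : Submodule.span K {y | ∃ x a, act x a = y} = ⊤
  gr : ℤ → Submodule K carrier
  isInternal : DirectSum.IsInternal gr
  act_mem : ∀ {p q : ℤ} {x : carrier} {a : A.carrier},
    x ∈ gr p → a ∈ A.gr q → act x a ∈ gr (p + q)

attribute [instance] GrMod.addCommGroup GrMod.module

/-- The homogeneous morphisms `M → N` of degree `n` in `GR-A`: the morphisms of right `A`-modules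
which map `M^k` to `N^(k+n)` for all `k`. -/
def GrMod.HOM {A : DGAlg.{u, v} K} (M N : GrMod.{u, v, w} A) (n : ℤ) :
    Submodule K (M.carrier →ₗ[K] N.carrier) where
  carrier := {f | (∀ x a, f (M.act x a) = N.act (f x) a) ∧
    ∀ k l, k + n = l → ∀ x ∈ M.gr k, f x ∈ N.gr l}
  zero_mem' := ⟨by simp, by simp⟩
  add_mem' {f g} hf hg := ⟨fun x a => by simp [hf.1, hg.1],
    fun k l h x hx => add_mem (hf.2 k l h x hx) (hg.2 k l h x hx)⟩
  smul_mem' c f hf := ⟨fun x a => by simp [hf.1],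
    fun k l h x hx => Submodule.smul_mem _ c (hf.2 k l h x hx)⟩

/-- The category `Gr-A` of graded right `A`-modules. -/
instance (A : DGAlg.{u, v} K) : Category.{w} (GrMod.{u, v, w} A) where
  Hom M N := M.HOM N 0
  id M := ⟨LinearMap.id, fun _ _ => rfl, fun k l h x hx => by
    obtain rfl : k = l := by omega
    exact hx⟩
  comp f g := ⟨g.1 ∘ₗ f.1, fun x a => by simp [f.2.1, g.2.1],
    fun k l h x hx => g.2.2 l l (add_zero l) _ (f.2.2 k l h x hx)⟩

instance (A : DGAlg.{u, v} K) : Preadditive (GrMod.{u, v, w} A) where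
  homGroup M N := inferInstanceAs (AddCommGroup (M.HOM N 0))
  add_comp _ _ _ f f' g := Subtype.ext (LinearMap.ext fun x => map_add g.1 (f.1 x) (f'.1 x))
  comp_add _ _ _ _ _ _ := rfl

/-- A right dg `A`-module. -/
structure DGMod (A : DGAlg.{u, v} K) extends GrMod.{u, v, w} A where
  d : carrier →ₗ[K] carrier
  d_mem : ∀ {p : ℤ} {x : carrier}, x ∈ gr p → d x ∈ gr (p + 1)
  d_d : ∀ x, d (d x) = 0
  leibniz : ∀ {p : ℤ} {x : carrier} (a : A.carrier), x ∈ gr p →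
    d (act x a) = act (d x) a + p.negOnePow • act x (A.d a)

namespace DGMod

variable {A : DGAlg.{u, v} K}

lemma induction_gr (M : GrMod.{u, v, w} A) {p : M.carrier → Prop} (x : M.carrier)
    (h : ∀ k, ∀ x ∈ M.gr k, p x) (h0 : p 0) (hadd : ∀ x y, p x → p y → p (x + y)) : p x :=
  Submodule.iSup_induction M.gr (motive := p)
    (by rw [M.isInternal.submodule_iSup_eq_top]; trivial) h h0 hadd

/-- The differential `f ↦ d_N ∘ f - (-1)^n f ∘ d_M` on homogeneous morphisms of degree `n`. -/
def dHOM (M N : DGMod.{u, v, w} A) (n m : ℤ) (h : n + 1 = m) :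
    M.toGrMod.HOM N.toGrMod n →ₗ[K] M.toGrMod.HOM N.toGrMod m where
  toFun f := ⟨N.d ∘ₗ f.1 - n.negOnePow • (f.1 ∘ₗ M.d), by
    refine ⟨fun x a => ?_, fun k l hl x hx => ?_⟩
    · refine induction_gr M.toGrMod (p := fun x => (N.d ∘ₗ f.1 - n.negOnePow • (f.1 ∘ₗ M.d))
          (M.act x a) = N.act ((N.d ∘ₗ f.1 - n.negOnePow • (f.1 ∘ₗ M.d)) x) a) x
        (fun k x hx => ?_) (by simp)
        (fun x y hx hy => by simp only [map_add, LinearMap.add_apply, hx, hy])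
      simp only [LinearMap.sub_apply, LinearMap.comp_apply, LinearMap.smul_apply, Units.smul_def,
        map_sub, f.2.1, M.leibniz a hx, N.leibniz a (f.2.2 k _ rfl x hx), map_add, map_zsmul,
        smul_add, smul_smul, Int.negOnePow_add, Units.val_mul]
      rw [mul_comm]
      abel
    · simp only [LinearMap.sub_apply, LinearMap.comp_apply, LinearMap.smul_apply, Units.smul_def]
      refine sub_mem ?_ (zsmul_mem (f.2.2 (k + 1) l (by omega) _ (M.d_mem hx)) _)
      have := N.d_mem (f.2.2 k (k + n) rfl x hx)
      rwa [show k + n + 1 = l by omega] at this⟩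
  map_add' f g := by
    ext x
    simp only [Submodule.coe_add, LinearMap.sub_apply, LinearMap.comp_apply, LinearMap.smul_apply,
      LinearMap.add_apply, map_add, smul_add]
    abel
  map_smul' c f := by
    ext x
    simp only [Submodule.coe_smul, LinearMap.sub_apply, LinearMap.comp_apply, LinearMap.smul_apply,
      map_smul, smul_sub, Units.smul_def, RingHom.id_apply]
    rw [smul_comm c]

/-- The dg category `Dg-A` of right dg `A`-modules. -/
instance : DGCategory.{u, w} K (DGMod.{u, v, w} A) where
  Hom M N n := M.toGrMod.HOM N.toGrMod n
  d {M N} n m h := dHOM M N n m h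
  id M := ⟨LinearMap.id, fun _ _ => rfl, fun k l h x hx => by
    obtain rfl : k = l := by omega
    exact hx⟩
  comp {M N P} p q r h := LinearMap.mk₂ K
    (fun f g => ⟨g.1 ∘ₗ f.1, fun x a => by simp [f.2.1, g.2.1],
      fun k l hl x hx => g.2.2 (k + p) l (by omega) _ (f.2.2 k _ rfl x hx)⟩)
    (fun f f' g => Subtype.ext (LinearMap.ext fun x => map_add g.1 (f.1 x) (f'.1 x)))
    (fun c f g => Subtype.ext (LinearMap.ext fun x => map_smul g.1 c (f.1 x)))
    (fun _ _ _ => rfl) (fun _ _ _ => rfl)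
  d_d {M N} n m l h h' f := Subtype.ext <| LinearMap.ext fun x => by
    subst h
    simp [dHOM, M.d_d, N.d_d, Int.negOnePow_succ]
  id_comp _ _ _ := rfl
  comp_id _ _ _ := rfl
  assoc _ _ _ _ _ _ _ _ _ _ _ _ _ := rfl
  leibniz {M N P} p q r p' q' r' h hp hq hr h₁ h₂ f g := Subtype.ext <| LinearMap.ext fun x => by
    subst h
    simp [dHOM, Units.smul_def, Int.negOnePow_add, smul_sub, smul_smul, mul_comm]

variable (A) in
/-- The category `C(A) = Z⁰(Dg-A)`. -/
abbrev CycleCat : Type (max u v (w + 1)) := DGCategory.ZeroCycle K (DGMod.{u, v, w} A)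

/-- The underlying dg module of an object of `C(A)`. -/
abbrev CycleCat.mod (M : CycleCat.{u, v, w} A) : DGMod.{u, v, w} A := M.as

/-- The linear map underlying a morphism in `C(A)`. -/
abbrev CycleCat.lin {M N : CycleCat.{u, v, w} A} (f : M ⟶ N) :
    M.mod.carrier →ₗ[K] N.mod.carrier :=
  (show M.mod.toGrMod.HOM N.mod.toGrMod 0 from DGCategory.ZeroCycle.val f).1

lemma CycleCat.hom_ext {M N : CycleCat.{u, v, w} A} {f g : M ⟶ N}
    (h : ∀ x, CycleCat.lin f x = CycleCat.lin g x) : f = g :=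
  Subtype.ext (Subtype.ext (LinearMap.ext h))

lemma CycleCat.lin_d {M N : CycleCat.{u, v, w} A} (f : M ⟶ N) (x : M.mod.carrier) :
    CycleCat.lin f (M.mod.d x) = N.mod.d (CycleCat.lin f x) := by
  have h := LinearMap.congr_fun (congrArg Subtype.val (LinearMap.mem_ker.1 f.2)) x
  have h' : N.mod.d (CycleCat.lin f x) - Int.negOnePow 0 • CycleCat.lin f (M.mod.d x) = 0 := h
  rw [Int.negOnePow_zero, one_smul, sub_eq_zero] at h'
  exact h'.symm

/-- Constructor for morphisms in `C(A)`. -/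
def CycleCat.mk {M N : DGMod.{u, v, w} A} (f : M.carrier →ₗ[K] N.carrier)
    (hf : f ∈ M.toGrMod.HOM N.toGrMod 0) (hd : ∀ x, f (M.d x) = N.d (f x)) :
    DGCategory.ZeroCycle.of K M ⟶ DGCategory.ZeroCycle.of K N :=
  ⟨⟨f, hf⟩, LinearMap.mem_ker.2 <| Subtype.ext <| LinearMap.ext fun x => by
    change N.d (f x) - Int.negOnePow 0 • f (M.d x) = 0
    rw [hd, Int.negOnePow_zero, one_smul, sub_self]⟩

variable (A) in
/-- The forgetful functor `C(A) ⥤ Gr-A`. -/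
def forget : CycleCat.{u, v, w} A ⥤ GrMod.{u, v, w} A where
  obj M := M.mod.toGrMod
  map f := f.1

instance : (forget.{u, v, w} A).PreservesZeroMorphisms where
  map_zero _ _ := rfl

variable (A) in
/-- The semi-split exact structure on `C(A)`: the conflations are the short exact sequences which
split in `Gr-A`. -/
def semiSplit : ObjectProperty (ShortComplex (CycleCat.{u, v, w} A)) := fun S =>
  Nonempty (S.map (forget A)).Splitting

/-- The shift `M[n]`: `M[n]^k = M^(k+n)`, the same action, and the differential `(-1)^n d`. -/
def shift (n : ℤ) (M : DGMod.{u, v, w} A) : DGMod.{u, v, w} A where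
  carrier := M.carrier
  act := M.act
  act_act := M.act_act
  unitary := M.unitary
  gr k := M.gr (k + n)
  isInternal := by
    rw [DirectSum.isInternal_submodule_iff_iSupIndep_and_iSup_eq_top]
    exact ⟨M.isInternal.submodule_iSupIndep.comp (add_left_injective n),
      ((Equiv.addRight n).iSup_comp (g := M.gr)).trans M.isInternal.submodule_iSup_eq_top⟩
  act_mem {p q x a} hx ha := by
    have := M.act_mem hx ha
    rwa [show p + n + q = p + q + n by ring] at this
  d := n.negOnePow • M.d
  d_mem {p x} hx := by
    have := M.d_mem hx
    rw [show p + n + 1 = p + 1 + n by ring] at this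
    exact zsmul_mem this _
  d_d x := by
    simp only [LinearMap.smul_apply, Units.smul_def, map_zsmul, M.d_d, smul_zero]
  leibniz {p x} a hx := by
    simp only [LinearMap.smul_apply, M.leibniz a hx, Units.smul_def, map_zsmul, smul_add, smul_smul,
      ← Units.val_mul, Int.negOnePow_add]
    rw [mul_left_comm, Int.units_mul_self, mul_one]

variable (A) in
/-- The functor `?[n]` on `C(A)`; it is the identity on underlying maps. -/
def shiftFun (n : ℤ) : CycleCat.{u, v, w} A ⥤ CycleCat.{u, v, w} A where
  obj M := .of K (shift n M.mod)
  map {M N} f := CycleCat.mk (M := shift n M.mod) (N := shift n N.mod) (CycleCat.lin (M := M) (N := N) f)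
    ⟨f.1.2.1, fun k l h x hx => f.1.2.2 (k + n) (l + n) (by omega) x hx⟩ (fun x =>
      (map_zsmul (CycleCat.lin (M := M) (N := N) f) (n.negOnePow : ℤ) (M.mod.d x)).trans
        (congrArg ((n.negOnePow : ℤ) • ·) (CycleCat.lin_d f x)))

/-- Constructor for isomorphisms in `C(A)`. -/
def CycleCat.mkIso {M N : DGMod.{u, v, w} A} (f : M.carrier →ₗ[K] N.carrier)
    (g : N.carrier →ₗ[K] M.carrier) (hf : f ∈ M.toGrMod.HOM N.toGrMod 0)
    (hg : g ∈ N.toGrMod.HOM M.toGrMod 0) (hd : ∀ x, f (M.d x) = N.d (f x))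
    (hfg : ∀ x, g (f x) = x) (hgf : ∀ x, f (g x) = x) :
    DGCategory.ZeroCycle.of K M ≅ DGCategory.ZeroCycle.of K N where
  hom := mk f hf hd
  inv := mk g hg fun x => by rw [← hfg (M.d (g x)), hd, hgf]
  hom_inv_id := hom_ext hfg
  inv_hom_id := hom_ext hgf

variable (A) in
/-- `M[0] ≅ M`, the identity on underlying modules. -/
def shiftFunZero : shiftFun.{u, v, w} A 0 ≅ 𝟭 _ :=
  NatIso.ofComponents (fun M => CycleCat.mkIso (M := shift 0 M.mod) (N := M.mod)
    LinearMap.id LinearMap.id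
    ⟨fun _ _ => rfl, fun k l h x hx => by
      obtain rfl : k + 0 = l := by omega
      exact hx⟩
    ⟨fun _ _ => rfl, fun k l h x hx => by
      obtain rfl : k = l + 0 := by omega
      exact hx⟩
    (fun x => by
      change Int.negOnePow 0 • M.mod.d x = M.mod.d x
      rw [Int.negOnePow_zero, one_smul])
    (fun _ => rfl) (fun _ => rfl)) (fun _ => rfl)

variable (A) in
/-- `M[n + m] ≅ M[n][m]`, the identity on underlying modules. -/
def shiftFunAdd (n m : ℤ) : shiftFun.{u, v, w} A (n + m) ≅ shiftFun A n ⋙ shiftFun A m :=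
  NatIso.ofComponents (fun M => CycleCat.mkIso (M := shift (n + m) M.mod)
    (N := shift m (shift n M.mod)) LinearMap.id LinearMap.id
    ⟨fun _ _ => rfl, fun k l h x hx => by
      obtain rfl : k = l := by omega
      change x ∈ M.mod.gr (k + m + n)
      rwa [show k + m + n = k + (n + m) by ring]⟩
    ⟨fun _ _ => rfl, fun k l h x hx => by
      obtain rfl : k = l := by omega
      change x ∈ M.mod.gr (k + (n + m))
      rwa [show k + (n + m) = k + m + n by ring]⟩
    (fun x => by
      change (n + m).negOnePow • M.mod.d x = m.negOnePow • n.negOnePow • M.mod.d x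
      rw [smul_smul, add_comm, Int.negOnePow_add])
    (fun _ => rfl) (fun _ => rfl)) (fun _ => rfl)

lemma CycleCat.eqToHom_shift (M : CycleCat.{u, v, w} A) {n m : ℤ} (h : n = m)
    (h' : (shiftFun A n).obj M = (shiftFun A m).obj M) (x : M.mod.carrier) :
    CycleCat.lin (eqToHom h') x = x := by
  subst h
  rfl

noncomputable instance : HasShift (CycleCat.{u, v, w} A) ℤ :=
  hasShiftMk _ _
    { F := shiftFun A
      zero := shiftFunZero A
      add := shiftFunAdd A
      assoc_hom_app := fun m₁ m₂ m₃ X => CycleCat.hom_ext fun x =>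
        (CycleCat.eqToHom_shift X (add_assoc m₁ m₂ m₃) _ x).symm
      zero_add_hom_app := fun n X => CycleCat.hom_ext fun x =>
        (CycleCat.eqToHom_shift X (zero_add n) _ x).symm
      add_zero_hom_app := fun n X => CycleCat.hom_ext fun x =>
        (CycleCat.eqToHom_shift X (add_zero n) _ x).symm }

lemma shiftFunctor_eq (n : ℤ) : shiftFunctor (CycleCat.{u, v, w} A) n = shiftFun A n := rfl

instance (n : ℤ) : (shiftFunctor (CycleCat.{u, v, w} A) n).Additive where
  map_add := rfl

/-- For `s : N → L` of degree `1` with `d(s) = d_L s + s d_N = 0`, the dg module `L ⊕ N` with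
differential `(d_L, s; 0, d_N)`. -/
def twist (L N : DGMod.{u, v, w} A) (s : N.carrier →ₗ[K] L.carrier)
    (hs : s ∈ N.toGrMod.HOM L.toGrMod 1) (hd : ∀ x, L.d (s x) + s (N.d x) = 0) :
    DGMod.{u, v, w} A where
  carrier := L.carrier × N.carrier
  act := LinearMap.mk₂ K (fun x a => (L.act x.1 a, N.act x.2 a))
    (fun _ _ _ => by simp) (fun _ _ _ => by simp) (fun _ _ _ => by simp) (fun _ _ _ => by simp)
  act_act x a b := by simp [L.act_act, N.act_act]
  unitary := by
    rw [eq_top_iff]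
    rintro ⟨x, y⟩ -
    have h₁ : ∀ x : L.carrier, ((x, 0) : L.carrier × N.carrier) ∈ Submodule.span K
        {z | ∃ (x : L.carrier × N.carrier) (a : A.carrier),
          (L.act x.1 a, N.act x.2 a) = z} := fun x => by
      have hx : x ∈ Submodule.span K {y | ∃ x a, L.act x a = y} := by rw [L.unitary]; trivial
      have := Submodule.mem_map_of_mem (f := LinearMap.inl K L.carrier N.carrier) hx
      rw [Submodule.map_span] at this
      refine Submodule.span_mono ?_ this
      rintro _ ⟨_, ⟨x, a, rfl⟩, rfl⟩
      exact ⟨(x, 0), a, by simp⟩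
    have h₂ : ∀ y : N.carrier, ((0, y) : L.carrier × N.carrier) ∈ Submodule.span K
        {z | ∃ (x : L.carrier × N.carrier) (a : A.carrier),
          (L.act x.1 a, N.act x.2 a) = z} := fun y => by
      have hy : y ∈ Submodule.span K {y | ∃ x a, N.act x a = y} := by rw [N.unitary]; trivial
      have := Submodule.mem_map_of_mem (f := LinearMap.inr K L.carrier N.carrier) hy
      rw [Submodule.map_span] at this
      refine Submodule.span_mono ?_ this
      rintro _ ⟨_, ⟨y, a, rfl⟩, rfl⟩
      exact ⟨(0, y), a, by simp⟩
    have := add_mem (h₁ x) (h₂ y)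
    rw [Prod.mk_add_mk, add_zero, zero_add] at this
    exact this
  gr k := (L.gr k).prod (N.gr k)
  isInternal := by
    rw [DirectSum.isInternal_submodule_iff_iSupIndep_and_iSup_eq_top]
    constructor
    · intro i
      rw [Submodule.disjoint_def]
      rintro ⟨x, y⟩ ⟨hx, hy⟩ hxy
      have h₁ := Submodule.mem_map_of_mem (f := LinearMap.fst K L.carrier N.carrier) hxy
      have h₂ := Submodule.mem_map_of_mem (f := LinearMap.snd K L.carrier N.carrier) hxy
      simp only [Submodule.map_iSup] at h₁ h₂
      have e₁ := (Submodule.disjoint_def.1 (L.isInternal.submodule_iSupIndep i)) x hx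
        ((iSup₂_mono (fun j _ => by rintro _ ⟨z, hz, rfl⟩; exact hz.1) :
          (⨆ j, ⨆ (_ : j ≠ i), Submodule.map (LinearMap.fst K L.carrier N.carrier)
            ((L.gr j).prod (N.gr j))) ≤ ⨆ j, ⨆ (_ : j ≠ i), L.gr j) h₁)
      have e₂ := (Submodule.disjoint_def.1 (N.isInternal.submodule_iSupIndep i)) y hy
        ((iSup₂_mono (fun j _ => by rintro _ ⟨z, hz, rfl⟩; exact hz.2) :
          (⨆ j, ⨆ (_ : j ≠ i), Submodule.map (LinearMap.snd K L.carrier N.carrier)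
            ((L.gr j).prod (N.gr j))) ≤ ⨆ j, ⨆ (_ : j ≠ i), N.gr j) h₂)
      rw [e₁, e₂]
      rfl
    · rw [eq_top_iff]
      rintro ⟨x, y⟩ -
      have h₁ : ((x, 0) : L.carrier × N.carrier) ∈ ⨆ k, (L.gr k).prod (N.gr k) :=
        induction_gr L.toGrMod
          (p := fun x => ((x, 0) : L.carrier × N.carrier) ∈ ⨆ k, (L.gr k).prod (N.gr k)) x
          (fun k x hx => Submodule.mem_iSup_of_mem k ⟨hx, zero_mem _⟩) (zero_mem _)
          (fun a b ha hb => by simpa using add_mem ha hb)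
      have h₂ : ((0, y) : L.carrier × N.carrier) ∈ ⨆ k, (L.gr k).prod (N.gr k) :=
        induction_gr N.toGrMod
          (p := fun y => ((0, y) : L.carrier × N.carrier) ∈ ⨆ k, (L.gr k).prod (N.gr k)) y
          (fun k x hx => Submodule.mem_iSup_of_mem k ⟨zero_mem _, hx⟩) (zero_mem _)
          (fun a b ha hb => by simpa using add_mem ha hb)
      simpa using add_mem h₁ h₂
  act_mem hx ha := ⟨L.act_mem hx.1 ha, N.act_mem hx.2 ha⟩
  d := (L.d ∘ₗ LinearMap.fst K _ _ + s ∘ₗ LinearMap.snd K _ _).prod (N.d ∘ₗ LinearMap.snd K _ _)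
  d_mem hx := ⟨add_mem (L.d_mem hx.1) (hs.2 _ _ rfl _ hx.2), N.d_mem hx.2⟩
  d_d x := Prod.ext (by simpa [L.d_d] using hd x.2) (N.d_d x.2)
  leibniz {p x} a hx := by
    refine Prod.ext ?_ (N.leibniz a hx.2)
    change L.d (L.act x.1 a) + s (N.act x.2 a) =
      L.act (L.d x.1 + s x.2) a + p.negOnePow • L.act x.1 (A.d a)
    rw [L.leibniz a hx.1, hs.1, map_add, LinearMap.add_apply]
    abel

/-- The inclusion `L ⟶ L ⊕ N`. -/
def twistInl (L N : DGMod.{u, v, w} A) (s : N.carrier →ₗ[K] L.carrier)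
    (hs : s ∈ N.toGrMod.HOM L.toGrMod 1) (hd : ∀ x, L.d (s x) + s (N.d x) = 0) :
    DGCategory.ZeroCycle.of K L ⟶ DGCategory.ZeroCycle.of K (twist L N s hs hd) :=
  CycleCat.mk (N := twist L N s hs hd) (LinearMap.inl K L.carrier N.carrier)
    ⟨fun x a => Prod.ext rfl (by
        change (0 : N.carrier) = N.act 0 a
        rw [map_zero, LinearMap.zero_apply]), fun k l h x hx => by
      obtain rfl : k = l := by omega
      exact Submodule.mem_prod.2 ⟨hx, zero_mem _⟩⟩
    (fun x => Prod.ext (by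
      change L.d x = L.d x + s 0
      rw [map_zero, add_zero]) (map_zero N.d).symm)

/-- The projection `L ⊕ N ⟶ N`. -/
def twistSnd (L N : DGMod.{u, v, w} A) (s : N.carrier →ₗ[K] L.carrier)
    (hs : s ∈ N.toGrMod.HOM L.toGrMod 1) (hd : ∀ x, L.d (s x) + s (N.d x) = 0) :
    DGCategory.ZeroCycle.of K (twist L N s hs hd) ⟶ DGCategory.ZeroCycle.of K N :=
  CycleCat.mk (M := twist L N s hs hd) (LinearMap.snd K L.carrier N.carrier)
    ⟨fun _ _ => rfl, fun k l h x hx => by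
      obtain rfl : k = l := by omega
      exact (Submodule.mem_prod.1 hx).2⟩ (fun _ => rfl)

/-- The zero dg module. -/
def zero (A : DGAlg.{u, v} K) : DGMod.{u, v, w} A where
  carrier := PUnit
  act := 0
  act_act _ _ _ := rfl
  unitary := Subsingleton.elim _ _
  gr _ := ⊥
  isInternal := by
    rw [DirectSum.isInternal_submodule_iff_iSupIndep_and_iSup_eq_top]
    exact ⟨fun _ => disjoint_bot_left, Subsingleton.elim _ _⟩
  act_mem _ _ := rfl
  d := 0
  d_mem _ := rfl
  d_d _ := rfl
  leibniz _ _ := rfl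

instance : HasZeroObject (CycleCat.{u, v, w} A) :=
  ⟨.of K (zero A), by
    rw [IsZero.iff_id_eq_zero]
    exact CycleCat.hom_ext fun x => rfl⟩

/-- The direct sum of two dg modules. -/
def prod (L N : DGMod.{u, v, w} A) : DGMod.{u, v, w} A := twist L N 0 (zero_mem _) (by simp)

instance : HasBinaryBiproducts (CycleCat.{u, v, w} A) where
  has_binary_biproduct L N := hasBinaryBiproduct_of_total
    { pt := .of K (prod L.mod N.mod)
      fst := CycleCat.mk (M := prod L.mod N.mod) (N := L.mod) (LinearMap.fst K _ _)
        ⟨fun _ _ => rfl, fun k l h x hx => by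
          obtain rfl : k = l := by omega
          exact (Submodule.mem_prod.1 hx).1⟩ (fun x => add_zero _)
      snd := twistSnd L.mod N.mod 0 _ _
      inl := twistInl L.mod N.mod 0 _ _
      inr := CycleCat.mk (M := N.mod) (N := prod L.mod N.mod) (LinearMap.inr K _ _)
        ⟨fun x a => Prod.ext (by
            change (0 : L.mod.carrier) = L.mod.act 0 a
            rw [map_zero, LinearMap.zero_apply]) rfl, fun k l h x hx => by
          obtain rfl : k = l := by omega
          exact ⟨zero_mem _, hx⟩⟩ (fun x => Prod.ext (by
            change (0 : L.mod.carrier) = L.mod.d 0 + 0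
            rw [map_zero, add_zero]) rfl)
      inl_fst := CycleCat.hom_ext fun _ => rfl
      inl_snd := CycleCat.hom_ext fun _ => rfl
      inr_fst := CycleCat.hom_ext fun _ => rfl
      inr_snd := CycleCat.hom_ext fun _ => rfl }
    (CycleCat.hom_ext fun x => Prod.ext (add_zero _) (zero_add _))

lemma semiSplit_shift (n : ℤ) (S : ShortComplex (CycleCat.{u, v, w} A)) (hS : semiSplit A S) :
    semiSplit A (S.map (shiftFunctor _ n)) := by
  obtain ⟨σ⟩ := hS
  exact ⟨{
    r := ⟨σ.r.1, σ.r.2.1, fun k l h x hx => σ.r.2.2 (k + n) (l + n) (by omega) x hx⟩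
    s := ⟨σ.s.1, σ.s.2.1, fun k l h x hx => σ.s.2.2 (k + n) (l + n) (by omega) x hx⟩
    f_r := Subtype.ext (congrArg Subtype.val σ.f_r :)
    s_g := Subtype.ext (congrArg Subtype.val σ.s_g :)
    id := Subtype.ext (congrArg Subtype.val σ.id :) }⟩

lemma isRelProjective_shift (n : ℤ) (P : CycleCat.{u, v, w} A)
    (hP : IsRelProjective (semiSplit A) P) :
    IsRelProjective (semiSplit A) (P⟦n⟧) := fun S hS f => by
  let adj := (shiftEquiv (CycleCat.{u, v, w} A) n).toAdjunction
  obtain ⟨g, hg⟩ := hP _ (semiSplit_shift (-n) S hS) (adj.homEquiv P S.X₃ f)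
  refine ⟨(adj.homEquiv P S.X₂).symm g, ?_⟩
  exact (adj.homEquiv_naturality_right_symm g S.g).symm.trans ((Equiv.symm_apply_eq _).2 hg)

instance : (stableRel (semiSplit.{u, v, w} A)).IsCompatibleWithShift ℤ where
  condition n X Y f g := by
    rintro ⟨P, a, b, hP, h⟩
    exact ⟨P⟦n⟧, a⟦n⟧', b⟦n⟧', isRelProjective_shift n P hP, by
      rw [← Functor.map_sub, h, Functor.map_comp]⟩

lemma CycleCat.lin_mem_HOM_one {M N : CycleCat.{u, v, w} A} (f : M ⟶ N) :
    CycleCat.lin f ∈ (shift 1 M.mod).toGrMod.HOM N.mod.toGrMod 1 :=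
  ⟨f.1.2.1, fun k l h x hx => f.1.2.2 (k + 1) l (by omega) x hx⟩

lemma CycleCat.d_lin_shift {M N : CycleCat.{u, v, w} A} (f : M ⟶ N) (x : M.mod.carrier) :
    N.mod.d (CycleCat.lin f x) + CycleCat.lin f ((shift 1 M.mod).d x) = 0 := by
  have h : (shift 1 M.mod).d x = -M.mod.d x := neg_one_zsmul (M.mod.d x)
  rw [h]
  exact (congrArg (_ + ·) (map_neg (CycleCat.lin f) _)).trans
    ((congrArg (_ + -·) (CycleCat.lin_d f x)).trans (add_neg_cancel _))

/-- The cone `C(f) = N ⊕ M[1]` of a morphism `f : M ⟶ N` in `C(A)`, with differential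
`(d_N, f; 0, d_{M[1]})`. -/
noncomputable def cone {M N : CycleCat.{u, v, w} A} (f : M ⟶ N) : CycleCat.{u, v, w} A :=
  .of K (twist N.mod (shift 1 M.mod) (CycleCat.lin (M := M) (N := N) f) (CycleCat.lin_mem_HOM_one f)
    (CycleCat.d_lin_shift f))

/-- The canonical morphism `N ⟶ C(f)`. -/
noncomputable def coneInl {M N : CycleCat.{u, v, w} A} (f : M ⟶ N) : N ⟶ cone f :=
  twistInl N.mod (shift 1 M.mod) _ _ _

/-- The canonical morphism `C(f) ⟶ M[1]`. -/
noncomputable def coneSnd {M N : CycleCat.{u, v, w} A} (f : M ⟶ N) : cone f ⟶ M⟦(1 : ℤ)⟧ :=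
  twistSnd N.mod (shift 1 M.mod) _ _ _

lemma coneInl_coneSnd {M N : CycleCat.{u, v, w} A} (f : M ⟶ N) : coneInl f ≫ coneSnd f = 0 := rfl

variable (A) in
/-- The homotopy category `H(A)`: the stable category of `C(A)` with its semi-split exact
structure. -/
abbrev HtpyCat : Type (max u v (w + 1)) := StableCategory (semiSplit.{u, v, w} A)

variable (A) in
/-- The projection functor `C(A) ⥤ H(A)`. -/
noncomputable abbrev toHtpyCat : CycleCat.{u, v, w} A ⥤ HtpyCat.{u, v, w} A :=
  StableCategory.proj (semiSplit A)

/-- A triangle `L ⟶ M ⟶ N ⟶ L[1]` in `C(A)` comes from a conflation if `0 ⟶ L ⟶ M ⟶ N ⟶ 0` is a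
conflation and its third morphism is `-w`, for a morphism `w : N ⟶ L[1]` which fits in a morphism
`(1, g, w)` from this conflation to the canonical one `0 ⟶ L ⟶ C(1_L) ⟶ L[1] ⟶ 0`.
(With this usual sign, the image in `H(A)` of `M ⟶ N ⟶ C(f) ⟶ M[1]` is isomorphic to the image of
such a triangle, for every `f : M ⟶ N`.) -/
def IsConflationTriangle (T : Pretriangulated.Triangle (CycleCat.{u, v, w} A)) : Prop :=
  ∃ h : T.mor₁ ≫ T.mor₂ = 0, semiSplit A (ShortComplex.mk T.mor₁ T.mor₂ h) ∧
    ∃ (g : T.obj₂ ⟶ cone (𝟙 T.obj₁)) (w : T.obj₃ ⟶ T.obj₁⟦(1 : ℤ)⟧),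
      T.mor₁ ≫ g = coneInl (𝟙 T.obj₁) ∧ T.mor₂ ≫ w = g ≫ coneSnd (𝟙 T.obj₁) ∧ T.mor₃ = -w

end DGMod

end Modules

/-! A conflation `X ⟶ Y ⟶ Z` with graded splitting `(r, s)` is governed by its cocycle `ω = r d s :
Z → X`, an `A`-linear map of degree 1 with `dω + ωd = 0`: up to isomorphism, `Y` is `X ⊕ Z` with
differential `(d, ω; 0, d)` (`GrSplit`, `twist`). The axioms of an exact category become operations
on cocycles. Pushout along `f` replaces `ω` by `f ω`, pullback replaces it by `ω f`, and the
cokernel of a composite inflation and the kernel of a composite deflation are again twisted sums.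

The projectives and the injectives are both the contractible modules, those with `1 = dσ + σd`: a
contraction turns a graded lift or extension into one which commutes with the differentials. A
twisted sum along an invertible cocycle is contractible (`isContractible_tw`). This applies to
`C(1_M)` and to `M[-1] ⊕ M`, so there are enough injectives and projectives, and each of them is a
retract of a contractible module.

Stable equality is therefore homotopy (`stableRel_eq_boundaryRel`): a map through a contractible
module is null-homotopic, and a homotopy from `f` to `g` is precisely what extends `f - g` from `M`
to `C(1_M)`. Thus `H(A)` and `H⁰(Dg-A)` are quotients of `C(A)` by the same relation.

The triangulated structure is built from the standard triangles `M ⟶ N ⟶ C(f) ⟶ M[1]`, each axiom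
coming down to an explicit map of cones or homotopy equivalence. For a conflation `(u, v)` the third
term is homotopy equivalent to `C(u)`, so its triangle is standard up to isomorphism
(`mem_distTriangles_of_grSplit`). Conversely, a standard triangle is isomorphic to the rotation of
another one (`exists_iso_rotate_coneTriangle`), and such a rotation comes from the conflation `N ⟶
C(f) ⟶ M[1]`. Coproducts are direct sums, because homotopies chosen on the summands assemble into
one on the sum. -/

namespace DGMod

variable {K : Type u} [CommRing K] {A : DGAlg.{u, v} K}

/-! ### Underlying linear maps, homotopies and twisted sums -/

namespace CycleCat

/-- The linear map underlying a morphism in `C(A)`: a version of `CycleCat.lin` which is not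
reducible, so that `simp` and `rw` can use its lemmas. -/
def app {M N : CycleCat.{u, v, w} A} (f : M ⟶ N) : M.mod.carrier →ₗ[K] N.mod.carrier :=
  CycleCat.lin f

variable {M N P : CycleCat.{u, v, w} A}

lemma ext {f g : M ⟶ N} (h : ∀ x, app f x = app g x) : f = g := hom_ext h

@[simp] lemma app_id (x : M.mod.carrier) : app (𝟙 M) x = x := rfl
@[simp] lemma app_comp (f : M ⟶ N) (g : N ⟶ P) (x : M.mod.carrier) :
    app (f ≫ g) x = app g (app f x) := rfl
@[simp] lemma app_sub (f g : M ⟶ N) (x : M.mod.carrier) : app (f - g) x = app f x - app g x := rfl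

lemma app_d (f : M ⟶ N) (x : M.mod.carrier) : app f (M.mod.d x) = N.mod.d (app f x) := lin_d f x
lemma app_mem (f : M ⟶ N) : app f ∈ M.mod.toGrMod.HOM N.mod.toGrMod 0 := f.1.2

end CycleCat

open CycleCat

section HOM

variable {M N P : GrMod.{u, v, w} A}

lemma HOM_comp {p q r : ℤ} (h : p + q = r) {f : M.carrier →ₗ[K] N.carrier}
    {g : N.carrier →ₗ[K] P.carrier} (hf : f ∈ M.HOM N p) (hg : g ∈ N.HOM P q) :
    g ∘ₗ f ∈ M.HOM P r :=
  ⟨fun x a => by simp [hf.1, hg.1], fun k l hl x hx =>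
    hg.2 (k + p) l (by omega) _ (hf.2 k _ rfl x hx)⟩

end HOM

/-- Morphisms of `C(A)` differ by a boundary if and only if they are homotopic. -/
lemma boundaryRel_iff {M N : CycleCat.{u, v, w} A} (f g : M ⟶ N) :
    DGCategory.boundaryRel K (DGMod.{u, v, w} A) f g ↔
      ∃ σ ∈ M.mod.toGrMod.HOM N.mod.toGrMod (-1),
        ∀ x, app f x - app g x = N.mod.d (σ x) + σ (M.mod.d x) := by
  -- In degree `-1` the sign in the differential of `HOM` is `-1`, so the boundary of `σ` is `dσ +
  -- σd`.
  have key : ∀ (σ : M.mod.carrier →ₗ[K] N.mod.carrier) (x : M.mod.carrier),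
      (N.mod.d ∘ₗ σ - (-1 : ℤ).negOnePow • (σ ∘ₗ M.mod.d)) x
        = N.mod.d (σ x) + σ (M.mod.d x) := fun σ x => by
    simp [Units.smul_def]
  constructor
  · rintro ⟨σ, h⟩
    exact ⟨σ.1, σ.2, fun x => (LinearMap.congr_fun (congrArg Subtype.val h) x).trans (key σ.1 x)⟩
  · rintro ⟨σ, hσ, h⟩
    exact ⟨⟨σ, hσ⟩, Subtype.ext (LinearMap.ext fun x => (h x).trans (key σ x).symm)⟩

/-- The twisted direct sum `L ⊕ N` as an object of `C(A)`. -/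
abbrev tw (L N : CycleCat.{u, v, w} A) (s : N.mod.carrier →ₗ[K] L.mod.carrier)
    (hs : s ∈ N.mod.toGrMod.HOM L.mod.toGrMod 1)
    (hd : ∀ x, L.mod.d (s x) + s (N.mod.d x) = 0) : CycleCat.{u, v, w} A :=
  .of K (twist L.mod N.mod s hs hd)

section Twist

variable {L N P : CycleCat.{u, v, w} A} {s : N.mod.carrier →ₗ[K] L.mod.carrier}
  {hs : s ∈ N.mod.toGrMod.HOM L.mod.toGrMod 1} {hd : ∀ x, L.mod.d (s x) + s (N.mod.d x) = 0}

/-- A graded map `P → L` and a morphism `P ⟶ N` which define a morphism to the twisted sum. -/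
def twLift (a : P.mod.carrier →ₗ[K] L.mod.carrier) (ha : a ∈ P.mod.toGrMod.HOM L.mod.toGrMod 0)
    (b : P ⟶ N) (h : ∀ x, a (P.mod.d x) = L.mod.d (a x) + s (app b x)) : P ⟶ tw L N s hs hd :=
  CycleCat.mk (M := P.mod) (N := twist L.mod N.mod s hs hd) (a.prod (app b))
    ⟨fun x c => Prod.ext (ha.1 x c) ((app_mem b).1 x c),
      fun k l h x hx => ⟨ha.2 k l h x hx, (app_mem b).2 k l h x hx⟩⟩
    fun x => Prod.ext (h x) (app_d b x)

/-- A morphism `L ⟶ P` and a graded map `N → P` which define a morphism on the twisted sum. -/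
def twDesc (a : L ⟶ P) (b : N.mod.carrier →ₗ[K] P.mod.carrier)
    (hb : b ∈ N.mod.toGrMod.HOM P.mod.toGrMod 0)
    (h : ∀ y, P.mod.d (b y) = app a (s y) + b (N.mod.d y)) : tw L N s hs hd ⟶ P :=
  CycleCat.mk (M := twist L.mod N.mod s hs hd) (N := P.mod) ((app a).coprod b)
    ⟨fun x c => by
      change app a (L.mod.act x.1 c) + b (N.mod.act x.2 c) = P.mod.act (app a x.1 + b x.2) c
      rw [(app_mem a).1, hb.1, map_add, LinearMap.add_apply],
      fun k l h x hx => add_mem ((app_mem a).2 k l h _ hx.1) (hb.2 k l h _ hx.2)⟩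
    fun x => by
      change app a (L.mod.d x.1 + s x.2) + b (N.mod.d x.2) = P.mod.d (app a x.1 + b x.2)
      rw [map_add, map_add, app_d, h, add_assoc]

end Twist

/-! ### Graded splittings and their cocycles -/

/-- Graded splittings of a sequence `X ⟶ Y ⟶ Z` in `C(A)`. -/
structure GrSplit {X Y Z : CycleCat.{u, v, w} A} (i : X ⟶ Y) (p : Y ⟶ Z) where
  r : Y.mod.carrier →ₗ[K] X.mod.carrier
  s : Z.mod.carrier →ₗ[K] Y.mod.carrier
  r_mem : r ∈ Y.mod.toGrMod.HOM X.mod.toGrMod 0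
  s_mem : s ∈ Z.mod.toGrMod.HOM Y.mod.toGrMod 0
  r_i : ∀ x, r (app i x) = x
  p_s : ∀ z, app p (s z) = z
  total : ∀ y, app i (r y) + s (app p y) = y

namespace GrSplit

variable {X Y Z : CycleCat.{u, v, w} A} {i : X ⟶ Y} {p : Y ⟶ Z} (h : GrSplit i p)
include h

/-- Evaluating `total` on the image of `i` gives `s p i = 0`, and `s` has the left inverse `p`. This
is why `GrSplit` need not assume that the composite vanishes. -/
lemma p_i (x : X.mod.carrier) : app p (app i x) = 0 := by
  have := h.total (app i x)
  rw [h.r_i, add_eq_left] at this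
  rw [← h.p_s (app p (app i x)), this, map_zero]

lemma r_s (z : Z.mod.carrier) : h.r (h.s z) = 0 := by
  have := h.total (h.s z)
  rw [h.p_s, add_eq_right] at this
  rw [← h.r_i (h.r (h.s z)), this, map_zero]

lemma zero : i ≫ p = 0 := CycleCat.ext h.p_i

/-- The degree `1` cocycle `Z → X` which classifies the conflation. -/
def cocycle : Z.mod.carrier →ₗ[K] X.mod.carrier := h.r ∘ₗ Y.mod.d ∘ₗ h.s

lemma cocycle_apply (z : Z.mod.carrier) : h.cocycle z = h.r (Y.mod.d (h.s z)) := rfl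

/-- The cocycle measures the failure of `r` to commute with the differentials; `d_s` is the dual
identity for `s`. Maps built from `r` and `s` are checked to be morphisms of `C(A)` through these
two identities. -/
lemma r_d (y : Y.mod.carrier) : h.r (Y.mod.d y) = X.mod.d (h.r y) + h.cocycle (app p y) := by
  conv_lhs => rw [← h.total y, map_add, map_add, ← app_d, h.r_i]
  rfl

lemma d_s (z : Z.mod.carrier) :
    Y.mod.d (h.s z) = app i (h.cocycle z) + h.s (Z.mod.d z) := by
  conv_lhs => rw [← h.total (Y.mod.d (h.s z)), app_d, h.p_s]
  rfl

/-- The Leibniz rule for `d (s z · a)` produces an extra term `± s z · da`, which `r` kills because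
`r s = 0`. That rule needs homogeneous elements, hence the appeal to `induction_gr`. -/
lemma cocycle_mem : h.cocycle ∈ Z.mod.toGrMod.HOM X.mod.toGrMod 1 := by
  refine ⟨fun z a => ?_, fun k l hkl z hz => ?_⟩
  · refine induction_gr Z.mod.toGrMod
      (p := fun z => h.cocycle (Z.mod.act z a) = X.mod.act (h.cocycle z) a) z (fun k z hz => ?_)
      (by simp) (fun x y hx hy => by simp only [map_add, LinearMap.add_apply, hx, hy])
    rw [cocycle_apply, cocycle_apply, h.s_mem.1, Y.mod.leibniz a (h.s_mem.2 k k (add_zero k) z hz),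
      map_add, h.r_mem.1, Units.smul_def, map_zsmul, h.r_mem.1, h.r_s, map_zero,
      LinearMap.zero_apply, smul_zero, add_zero]
  · exact h.r_mem.2 l l (add_zero l) _
      (hkl ▸ Y.mod.d_mem (h.s_mem.2 k k (add_zero k) z hz))

/-- This is `r_d` evaluated at `d (s z)`, where `d² = 0`. -/
lemma d_cocycle (z : Z.mod.carrier) : X.mod.d (h.cocycle z) + h.cocycle (Z.mod.d z) = 0 := by
  have h₁ := h.r_d (Y.mod.d (h.s z))
  rwa [Y.mod.d_d, map_zero, app_d, h.p_s, eq_comm] at h₁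

omit h

/-- The splitting of the conflation `L ⟶ L ⊕ N ⟶ N`. -/
def twist (L N : CycleCat.{u, v, w} A) (s : N.mod.carrier →ₗ[K] L.mod.carrier)
    (hs : s ∈ N.mod.toGrMod.HOM L.mod.toGrMod 1)
    (hd : ∀ x, L.mod.d (s x) + s (N.mod.d x) = 0) :
    GrSplit (Y := tw L N s hs hd) (twistInl L.mod N.mod s hs hd)
      (twistSnd L.mod N.mod s hs hd) where
  r := LinearMap.fst K L.mod.carrier N.mod.carrier
  s := LinearMap.inr K L.mod.carrier N.mod.carrier
  r_mem := ⟨fun _ _ => rfl, fun k l h x hx => by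
    obtain rfl : k = l := by omega
    exact (Submodule.mem_prod.1 hx).1⟩
  s_mem := ⟨fun x a => Prod.ext (by
      change (0 : L.mod.carrier) = L.mod.act 0 a
      rw [map_zero, LinearMap.zero_apply]) rfl, fun k l h x hx => by
    obtain rfl : k = l := by omega
    exact ⟨zero_mem _, hx⟩⟩
  r_i _ := rfl
  p_s _ := rfl
  total x := Prod.ext (add_zero x.1) (zero_add x.2)

/-- Graded splittings in `C(A)` are splittings of the image in `Gr-A`. -/
lemma semiSplit (h : GrSplit i p) : DGMod.semiSplit A (ShortComplex.mk i p h.zero) :=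
  ⟨{ r := ⟨h.r, h.r_mem⟩
     s := ⟨h.s, h.s_mem⟩
     f_r := Subtype.ext (LinearMap.ext h.r_i)
     s_g := Subtype.ext (LinearMap.ext h.p_s)
     id := Subtype.ext (LinearMap.ext h.total) }⟩

lemma of_semiSplit {S : ShortComplex (CycleCat.{u, v, w} A)} (hS : DGMod.semiSplit A S) :
    Nonempty (GrSplit S.f S.g) := by
  obtain ⟨σ⟩ := hS
  exact ⟨{
    r := σ.r.1
    s := σ.s.1
    r_mem := σ.r.2
    s_mem := σ.s.2
    r_i := fun x => LinearMap.congr_fun (congrArg Subtype.val σ.f_r) x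
    p_s := fun x => LinearMap.congr_fun (congrArg Subtype.val σ.s_g) x
    total := fun x => LinearMap.congr_fun (congrArg Subtype.val σ.id) x }⟩

end GrSplit

lemma isInflation_iff {X Y : CycleCat.{u, v, w} A} (i : X ⟶ Y) :
    IsInflation (semiSplit A) i ↔ ∃ (Z : _) (p : Y ⟶ Z), Nonempty (GrSplit i p) :=
  ⟨fun ⟨Z, p, _, h⟩ => ⟨Z, p, GrSplit.of_semiSplit h⟩,
    fun ⟨Z, p, ⟨h⟩⟩ => ⟨Z, p, h.zero, h.semiSplit⟩⟩

lemma isDeflation_iff {Y Z : CycleCat.{u, v, w} A} (p : Y ⟶ Z) :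
    IsDeflation (semiSplit A) p ↔ ∃ (X : _) (i : X ⟶ Y), Nonempty (GrSplit i p) :=
  ⟨fun ⟨X, i, _, h⟩ => ⟨X, i, GrSplit.of_semiSplit h⟩,
    fun ⟨X, i, ⟨h⟩⟩ => ⟨X, i, h.zero, h.semiSplit⟩⟩

/-! ### The exact structure: composition, pushouts, pullbacks, kernels and cokernels -/

namespace GrSplit

variable {X Y Z : CycleCat.{u, v, w} A} {i : X ⟶ Y} {p : Y ⟶ Z}

/-- The cokernel of `i ≫ j` is an extension of `Q` by `Z`, the pushout of the second conflation
along `p`. It is therefore the twisted sum along `p ω'`, with `ω'` the second cocycle, and `W`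
projects onto it by `(p r', q)`. -/
lemma exists_comp_inflation {W Q : CycleCat.{u, v, w} A} {j : Y ⟶ W} {q : W ⟶ Q}
    (h : GrSplit i p) (h' : GrSplit j q) :
    ∃ (T : _) (π : W ⟶ T), Nonempty (GrSplit (i ≫ j) π) := by
  let t : Q.mod.carrier →ₗ[K] Z.mod.carrier := app p ∘ₗ h'.cocycle
  have ht : t ∈ Q.mod.toGrMod.HOM Z.mod.toGrMod 1 :=
    HOM_comp (add_zero 1) h'.cocycle_mem (app_mem p)
  have htd : ∀ x, Z.mod.d (t x) + t (Q.mod.d x) = 0 := fun x => by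
    change Z.mod.d (app p (h'.cocycle x)) + app p (h'.cocycle (Q.mod.d x)) = 0
    rw [← app_d, ← map_add, h'.d_cocycle, map_zero]
  refine ⟨tw Z Q t ht htd, twLift (app p ∘ₗ h'.r) (HOM_comp (add_zero 0) h'.r_mem (app_mem p)) q
    (fun x => ?_), ⟨{
      r := h.r ∘ₗ h'.r
      s := LinearMap.coprod (app j ∘ₗ h.s) h'.s
      r_mem := HOM_comp (add_zero 0) h'.r_mem h.r_mem
      s_mem := ⟨fun x a => ?_, fun k l hl x hx => ?_⟩
      r_i := fun x => ?_
      p_s := fun x => Prod.ext ?_ ?_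
      total := fun x => ?_ }⟩⟩
  · change app p (h'.r (W.mod.d x)) = Z.mod.d (app p (h'.r x)) + app p (h'.cocycle (app q x))
    rw [h'.r_d, map_add, app_d]
  · change app j (h.s (Z.mod.act x.1 a)) + h'.s (Q.mod.act x.2 a) =
      W.mod.act (app j (h.s x.1) + h'.s x.2) a
    rw [h.s_mem.1, (app_mem j).1, h'.s_mem.1, map_add, LinearMap.add_apply]
  · exact add_mem ((app_mem j).2 k l hl _ (h.s_mem.2 k k (add_zero k) _ hx.1))
      (h'.s_mem.2 k l hl _ hx.2)
  · change h.r (h'.r (app j (app i x))) = x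
    rw [h'.r_i, h.r_i]
  · change app p (h'.r (app j (h.s x.1) + h'.s x.2)) = x.1
    rw [map_add, h'.r_i, h'.r_s, add_zero, h.p_s]
  · change app q (app j (h.s x.1) + h'.s x.2) = x.2
    rw [map_add, h'.p_i, h'.p_s, zero_add]
  · change app j (app i (h.r (h'.r x))) + (app j (h.s (app p (h'.r x))) + h'.s (app q x)) = x
    rw [← add_assoc, ← map_add, h.total, h'.total]

/-- Dually, the kernel of `p ≫ q` is the pullback of the first conflation along `j`: the twisted sum
of `X` and `Q` along `ω j`, embedded in `Y` by `(i, s j)`. -/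
lemma exists_comp_deflation {W Q : CycleCat.{u, v, w} A} {j : Q ⟶ Z} {q : Z ⟶ W}
    (h : GrSplit i p) (h' : GrSplit j q) :
    ∃ (T : _) (ι : T ⟶ Y), Nonempty (GrSplit ι (p ≫ q)) := by
  let t : Q.mod.carrier →ₗ[K] X.mod.carrier := h.cocycle ∘ₗ app j
  have ht : t ∈ Q.mod.toGrMod.HOM X.mod.toGrMod 1 :=
    HOM_comp (zero_add 1) (app_mem j) h.cocycle_mem
  have htd : ∀ x, X.mod.d (t x) + t (Q.mod.d x) = 0 := fun x => by
    change X.mod.d (h.cocycle (app j x)) + h.cocycle (app j (Q.mod.d x)) = 0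
    rw [app_d, h.d_cocycle]
  refine ⟨tw X Q t ht htd, twDesc i (h.s ∘ₗ app j) (HOM_comp (add_zero 0) (app_mem j) h.s_mem)
    (fun x => ?_), ⟨{
      r := LinearMap.prod h.r (h'.r ∘ₗ app p)
      s := h.s ∘ₗ h'.s
      r_mem := ⟨fun x a => Prod.ext (h.r_mem.1 x a) ?_, fun k l hl x hx =>
        ⟨h.r_mem.2 k l hl x hx, h'.r_mem.2 k l hl _ ((app_mem p).2 k k (add_zero k) x hx)⟩⟩
      s_mem := HOM_comp (add_zero 0) h'.s_mem h.s_mem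
      r_i := fun x => Prod.ext ?_ ?_
      p_s := fun x => ?_
      total := fun x => ?_ }⟩⟩
  · change Y.mod.d (h.s (app j x)) = app i (h.cocycle (app j x)) + h.s (app j (Q.mod.d x))
    rw [h.d_s, app_d]
  · change h'.r (app p (Y.mod.act x a)) = Q.mod.act (h'.r (app p x)) a
    rw [(app_mem p).1, h'.r_mem.1]
  · change h.r (app i x.1 + h.s (app j x.2)) = x.1
    rw [map_add, h.r_i, h.r_s, add_zero]
  · change h'.r (app p (app i x.1 + h.s (app j x.2))) = x.2
    rw [map_add, h.p_i, h.p_s, zero_add, h'.r_i]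
  · change app q (app p (h.s (h'.s x))) = x
    rw [h.p_s, h'.p_s]
  · change app i (h.r x) + h.s (app j (h'.r (app p x))) + h.s (h'.s (app q (app p x))) = x
    rw [add_assoc, ← map_add, h'.total, h.total]

/-- The new conflation has cocycle `f ω`. A map out of the pushout is forced to be `c.inl ∘ s` on
the summand `Z`, because `(x, z) = i' x + f' (s z)`. -/
lemma exists_pushout (h : GrSplit i p) {X' : CycleCat.{u, v, w} A} (f : X ⟶ X') :
    ∃ (Y' : _) (f' : Y ⟶ Y') (i' : X' ⟶ Y'),
      IsPushout i f f' i' ∧ IsInflation (DGMod.semiSplit A) i' := by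
  let t : Z.mod.carrier →ₗ[K] X'.mod.carrier := app f ∘ₗ h.cocycle
  have ht : t ∈ Z.mod.toGrMod.HOM X'.mod.toGrMod 1 :=
    HOM_comp (add_zero 1) h.cocycle_mem (app_mem f)
  have htd : ∀ x, X'.mod.d (t x) + t (Z.mod.d x) = 0 := fun x => by
    change X'.mod.d (app f (h.cocycle x)) + app f (h.cocycle (Z.mod.d x)) = 0
    rw [← app_d, ← map_add, h.d_cocycle, map_zero]
  let f' : Y ⟶ tw X' Z t ht htd :=
    twLift (app f ∘ₗ h.r) (HOM_comp (add_zero 0) h.r_mem (app_mem f)) p fun x => by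
      change app f (h.r (Y.mod.d x)) = X'.mod.d (app f (h.r x)) + app f (h.cocycle (app p x))
      rw [h.r_d, map_add, app_d]
  let i' : X' ⟶ tw X' Z t ht htd := twistInl X'.mod Z.mod t ht htd
  have w : i ≫ f' = f ≫ i' := CycleCat.ext fun x => Prod.ext
    (congrArg (app f) (h.r_i x)) (h.p_i x)
  refine ⟨_, f', i', ⟨⟨w⟩, ⟨PushoutCocone.IsColimit.mk w
    (fun c => twDesc c.inr (app c.inl ∘ₗ h.s) (HOM_comp (add_zero 0) h.s_mem (app_mem c.inl))
      (fun z => ?_)) (fun c => ?_) (fun c => ?_) (fun c m h₁ h₂ => ?_)⟩⟩,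
    (isInflation_iff _).2 ⟨_, _, ⟨GrSplit.twist X' Z t ht htd⟩⟩⟩
  · have e := LinearMap.congr_fun (congrArg app c.condition) (h.cocycle z)
    change app c.inl (app i (h.cocycle z)) = app c.inr (app f (h.cocycle z)) at e
    change c.pt.mod.d (app c.inl (h.s z)) =
      app c.inr (app f (h.cocycle z)) + app c.inl (h.s (Z.mod.d z))
    rw [← app_d, h.d_s, map_add, e]
  · refine CycleCat.ext fun y => ?_
    have e := LinearMap.congr_fun (congrArg app c.condition) (h.r y)
    change app c.inl (app i (h.r y)) = app c.inr (app f (h.r y)) at e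
    change app c.inr (app f (h.r y)) + app c.inl (h.s (app p y)) = app c.inl y
    rw [← e, ← map_add, h.total]
  · refine CycleCat.ext fun y => ?_
    change app c.inr y + app c.inl (h.s 0) = app c.inr y
    rw [map_zero, map_zero, add_zero]
  · refine CycleCat.ext fun (⟨x, z⟩ : X'.mod.carrier × Z.mod.carrier) => ?_
    have e₁ : app c.inl (h.s z) = app m (app f' (h.s z)) := by rw [← h₁]; rfl
    have e₂ : app c.inr x = app m (app i' x) := by rw [← h₂]; rfl
    change app m (x, z) = app c.inr x + app c.inl (h.s z)
    rw [e₁, e₂, ← map_add]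
    refine congrArg (app m) (Prod.ext ?_ ?_)
    · change x = x + app f (h.r (h.s z))
      rw [h.r_s, map_zero, add_zero]
    · change z = 0 + app p (h.s z)
      rw [h.p_s, zero_add]

/-- The new conflation has cocycle `ω f`. The first coordinate of the map into the pullback must be
`r ∘ c.fst`, since `r i = 1` and `r s = 0`; that it works is the identity `total`. -/
lemma exists_pullback (h : GrSplit i p) {Z' : CycleCat.{u, v, w} A} (f : Z' ⟶ Z) :
    ∃ (Y' : _) (f' : Y' ⟶ Y) (p' : Y' ⟶ Z'),
      IsPullback f' p' p f ∧ IsDeflation (DGMod.semiSplit A) p' := by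
  let t : Z'.mod.carrier →ₗ[K] X.mod.carrier := h.cocycle ∘ₗ app f
  have ht : t ∈ Z'.mod.toGrMod.HOM X.mod.toGrMod 1 :=
    HOM_comp (zero_add 1) (app_mem f) h.cocycle_mem
  have htd : ∀ x, X.mod.d (t x) + t (Z'.mod.d x) = 0 := fun x => by
    change X.mod.d (h.cocycle (app f x)) + h.cocycle (app f (Z'.mod.d x)) = 0
    rw [app_d, h.d_cocycle]
  let f' : tw X Z' t ht htd ⟶ Y :=
    twDesc i (h.s ∘ₗ app f) (HOM_comp (add_zero 0) (app_mem f) h.s_mem) fun x => by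
      change Y.mod.d (h.s (app f x)) = app i (h.cocycle (app f x)) + h.s (app f (Z'.mod.d x))
      rw [h.d_s, app_d]
  let p' : tw X Z' t ht htd ⟶ Z' := twistSnd X.mod Z'.mod t ht htd
  have w : f' ≫ p = p' ≫ f := CycleCat.ext fun x => by
    change app p (app i x.1 + h.s (app f x.2)) = app f x.2
    rw [map_add, h.p_i, h.p_s, zero_add]
  refine ⟨_, f', p', ⟨⟨w⟩, ⟨PullbackCone.IsLimit.mk w
    (fun c => twLift (h.r ∘ₗ app c.fst) (HOM_comp (add_zero 0) (app_mem c.fst) h.r_mem) c.snd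
      (fun z => ?_)) (fun c => ?_) (fun c => ?_) (fun c m h₁ h₂ => ?_)⟩⟩,
    (isDeflation_iff _).2 ⟨_, _, ⟨GrSplit.twist X Z' t ht htd⟩⟩⟩
  · have e := LinearMap.congr_fun (congrArg app c.condition) z
    change app p (app c.fst z) = app f (app c.snd z) at e
    change h.r (app c.fst (c.pt.mod.d z)) =
      X.mod.d (h.r (app c.fst z)) + h.cocycle (app f (app c.snd z))
    rw [app_d, h.r_d, e]
  · refine CycleCat.ext fun y => ?_
    have e := LinearMap.congr_fun (congrArg app c.condition) y
    change app p (app c.fst y) = app f (app c.snd y) at e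
    change app i (h.r (app c.fst y)) + h.s (app f (app c.snd y)) = app c.fst y
    rw [← e, h.total]
  · exact CycleCat.ext fun y => rfl
  · refine CycleCat.ext fun y => Prod.ext ?_ ?_
    · have e₁ : app c.fst y = app f' (app m y) := by rw [← h₁]; rfl
      change (app m y).1 = h.r (app c.fst y)
      rw [e₁]
      change (app m y).1 = h.r (app i (app m y).1 + h.s (app f (app m y).2))
      rw [map_add, h.r_i, h.r_s, add_zero]
    · change (app m y).2 = app c.snd y
      rw [← h₂]
      rfl

/-- The first morphism of a conflation is a kernel of the second one. -/
lemma isKernel (h : GrSplit i p) : Nonempty (IsLimit (KernelFork.ofι i h.zero)) := by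
  refine ⟨KernelFork.IsLimit.ofι i h.zero
    (fun {W} k hk => CycleCat.mk (M := W.mod) (N := X.mod) (h.r ∘ₗ app k)
      (HOM_comp (add_zero 0) (app_mem k) h.r_mem) fun x => ?_)
    (fun k hk => CycleCat.ext fun x => ?_)
    (fun k hk m hm => CycleCat.ext fun x => ?_)⟩
  all_goals have e (x) : app p (app k x) = 0 := LinearMap.congr_fun (congrArg app hk) x
  · change h.r (app k (W.mod.d x)) = X.mod.d (h.r (app k x))
    rw [app_d, h.r_d, e, map_zero, add_zero]
  · change app i (h.r (app k x)) = app k x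
    conv_rhs => rw [← h.total (app k x), e, map_zero, add_zero]
  · change app m x = h.r (app k x)
    rw [← hm, app_comp, h.r_i]

/-- The second morphism of a conflation is a cokernel of the first one. -/
lemma isCokernel (h : GrSplit i p) : Nonempty (IsColimit (CokernelCofork.ofπ p h.zero)) := by
  refine ⟨CokernelCofork.IsColimit.ofπ p h.zero
    (fun {W} k hk => CycleCat.mk (M := Z.mod) (N := W.mod) (app k ∘ₗ h.s)
      (HOM_comp (add_zero 0) h.s_mem (app_mem k)) fun x => ?_)
    (fun k hk => CycleCat.ext fun x => ?_)
    (fun k hk m hm => CycleCat.ext fun x => ?_)⟩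
  all_goals have e (x) : app k (app i x) = 0 := LinearMap.congr_fun (congrArg app hk) x
  · change app k (h.s (Z.mod.d x)) = W.mod.d (app k (h.s x))
    rw [← app_d, h.d_s, map_add, e, zero_add]
  · change app k (h.s (app p x)) = app k x
    conv_rhs => rw [← h.total x, map_add, e, zero_add]
  · change app m x = app k (h.s x)
    rw [← hm, app_comp, h.p_s]

open ZeroObject in
/-- The conflation `X ⟶ X ⟶ 0`. -/
noncomputable def idZero (X : CycleCat.{u, v, w} A) : GrSplit (𝟙 X) (0 : X ⟶ 0) where
  r := LinearMap.id
  s := 0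
  r_mem := app_mem (𝟙 X)
  s_mem := zero_mem _
  r_i _ := rfl
  -- The chosen zero object has no known carrier; its elements vanish because its identity is the
  -- zero morphism.
  p_s x := LinearMap.congr_fun (congrArg app ((isZero_zero _).eq_of_src 0 (𝟙 (0 : CycleCat A)))) x
  total x := add_zero x

open ZeroObject in
/-- The conflation `0 ⟶ X ⟶ X`. -/
noncomputable def zeroId (X : CycleCat.{u, v, w} A) : GrSplit (0 : 0 ⟶ X) (𝟙 X) where
  r := 0
  s := LinearMap.id
  r_mem := zero_mem _
  s_mem := app_mem (𝟙 X)
  r_i x := LinearMap.congr_fun (congrArg app ((isZero_zero _).eq_of_src 0 (𝟙 (0 : CycleCat A)))) x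
  p_s _ := rfl
  total x := zero_add x

end GrSplit

lemma isExactStructure_semiSplit : IsExactStructure (semiSplit.{u, v, w} A) where
  hasFiniteBiproducts := by
    have : HasFiniteProducts (CycleCat.{u, v, w} A) :=
      hasFiniteProducts_of_has_binary_and_terminal
    exact HasFiniteBiproducts.of_hasFiniteProducts
  closedUnderIso := ⟨fun e ⟨σ⟩ => ⟨σ.ofIso ((forget A).mapShortComplex.mapIso e)⟩⟩
  isKernel S hS := (GrSplit.of_semiSplit hS).elim fun h => h.isKernel
  isCokernel S hS := (GrSplit.of_semiSplit hS).elim fun h => h.isCokernel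
  inflation_id X := (isInflation_iff _).2 ⟨_, _, ⟨GrSplit.idZero X⟩⟩
  deflation_id X := (isDeflation_iff _).2 ⟨_, _, ⟨GrSplit.zeroId X⟩⟩
  inflation_comp i j hi hj := by
    obtain ⟨_, _, ⟨h⟩⟩ := (isInflation_iff _).1 hi
    obtain ⟨_, _, ⟨h'⟩⟩ := (isInflation_iff _).1 hj
    exact (isInflation_iff _).2 (h.exists_comp_inflation h')
  deflation_comp p q hp hq := by
    obtain ⟨_, _, ⟨h⟩⟩ := (isDeflation_iff _).1 hp
    obtain ⟨_, _, ⟨h'⟩⟩ := (isDeflation_iff _).1 hq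
    exact (isDeflation_iff _).2 (h.exists_comp_deflation h')
  pushout i f hi := by
    obtain ⟨_, _, ⟨h⟩⟩ := (isInflation_iff _).1 hi
    exact h.exists_pushout f
  pullback p f hp := by
    obtain ⟨_, _, ⟨h⟩⟩ := (isDeflation_iff _).1 hp
    exact h.exists_pullback f

/-! ### Contractible modules are the projectives and the injectives -/

section

variable {M N P : CycleCat.{u, v, w} A}

/-- For a graded map `τ` of degree `-1`, the morphism `dτ + τd` of `C(A)`. -/
def boundary (τ : M.mod.carrier →ₗ[K] N.mod.carrier)
    (hτ : τ ∈ M.mod.toGrMod.HOM N.mod.toGrMod (-1)) : M ⟶ N :=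
  ⟨DGCategory.d (K := K) (C := DGMod A) (-1) 0 (neg_add_cancel 1) ⟨τ, hτ⟩,
    LinearMap.mem_ker.2 (DGCategory.d_d _ _ _ _ _ _)⟩

lemma app_boundary (τ : M.mod.carrier →ₗ[K] N.mod.carrier)
    (hτ : τ ∈ M.mod.toGrMod.HOM N.mod.toGrMod (-1)) (x : M.mod.carrier) :
    app (boundary τ hτ) x = N.mod.d (τ x) + τ (M.mod.d x) := by
  change (N.mod.d ∘ₗ τ - (-1 : ℤ).negOnePow • (τ ∘ₗ M.mod.d)) x = _
  simp [Units.smul_def]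

/-- A dg module is contractible if its identity is a boundary. -/
def IsContractible (P : CycleCat.{u, v, w} A) : Prop :=
  ∃ σ ∈ P.mod.toGrMod.HOM P.mod.toGrMod (-1), ∀ x, x = P.mod.d (σ x) + σ (P.mod.d x)

/-- With `s` the graded section of the deflation, `s f σ` need not be a cycle, but its boundary is
one, and the deflation sends that boundary to `d f σ + f σ d = f (dσ + σd) = f`. -/
lemma IsContractible.isRelProjective (hP : IsContractible P) :
    IsRelProjective (semiSplit A) P := fun S hS f => by
  obtain ⟨σ, hσ, e⟩ := hP
  obtain ⟨h⟩ := GrSplit.of_semiSplit hS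
  refine ⟨boundary (h.s ∘ₗ app f ∘ₗ σ) (HOM_comp (add_zero (-1))
    (HOM_comp (add_zero (-1)) hσ (app_mem f)) h.s_mem), CycleCat.ext fun x => ?_⟩
  rw [app_comp, app_boundary]
  change app S.g (S.X₂.mod.d (h.s (app f (σ x))) + h.s (app f (σ (P.mod.d x)))) = app f x
  rw [map_add, app_d, h.p_s, h.p_s, ← app_d, ← map_add, ← e]

/-- Dually, the boundary of `σ f r` restricts to `(dσ + σd) f = f`. -/
lemma IsContractible.isRelInjective (hP : IsContractible P) :
    IsRelInjective (semiSplit A) P := fun S hS f => by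
  obtain ⟨σ, hσ, e⟩ := hP
  obtain ⟨h⟩ := GrSplit.of_semiSplit hS
  refine ⟨boundary (σ ∘ₗ app f ∘ₗ h.r) (HOM_comp (zero_add (-1))
    (HOM_comp (add_zero 0) h.r_mem (app_mem f)) hσ), CycleCat.ext fun x => ?_⟩
  rw [app_comp, app_boundary]
  change P.mod.d (σ (app f (h.r (app S.f x)))) + σ (app f (h.r (S.X₂.mod.d (app S.f x)))) = app f x
  rw [← app_d, h.r_i, h.r_i, app_d, ← e]

lemma IsContractible.of_retract (hP : IsContractible P) (a : M ⟶ P) (b : P ⟶ M)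
    (h : a ≫ b = 𝟙 M) : IsContractible M := by
  obtain ⟨σ, hσ, e⟩ := hP
  refine ⟨app b ∘ₗ σ ∘ₗ app a, HOM_comp (add_zero (-1)) (HOM_comp (zero_add (-1)) (app_mem a) hσ)
    (app_mem b), fun x => ?_⟩
  change x = M.mod.d (app b (σ (app a x))) + app b (σ (app a (M.mod.d x)))
  rw [← app_d, app_d a, ← map_add, ← e, ← app_comp, h, app_id]

/-- The twisted sum along an invertible cocycle is contractible. -/
lemma isContractible_tw {L N : CycleCat.{u, v, w} A} {s : N.mod.carrier →ₗ[K] L.mod.carrier}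
    {hs : s ∈ N.mod.toGrMod.HOM L.mod.toGrMod 1} {hd : ∀ x, L.mod.d (s x) + s (N.mod.d x) = 0}
    (t : L.mod.carrier →ₗ[K] N.mod.carrier) (ht : t ∈ L.mod.toGrMod.HOM N.mod.toGrMod (-1))
    (hst : ∀ x, s (t x) = x) (hts : ∀ x, t (s x) = x) : IsContractible (tw L N s hs hd) := by
  -- The contraction is `(x, y) ↦ (0, t x)`. The first coordinate of its boundary is `s t x = x`; in
  -- the second, the cocycle condition at `t x` gives `dt + td = 0`, which leaves `t s y = y`.
  refine ⟨(LinearMap.inr K L.mod.carrier N.mod.carrier ∘ₗ t) ∘ₗ LinearMap.fst K _ _,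
    HOM_comp (zero_add (-1)) (GrSplit.twist L N s hs hd).r_mem (HOM_comp (add_zero (-1)) ht
      (GrSplit.twist L N s hs hd).s_mem), fun x => Prod.ext ?_ ?_⟩
  · change x.1 = L.mod.d 0 + s (t x.1) + 0
    rw [map_zero, zero_add, add_zero, hst]
  · change x.2 = N.mod.d (t x.1) + t (L.mod.d x.1 + s x.2)
    have h := congrArg t (hd (t x.1))
    rw [hst, map_add, hts, map_zero] at h
    rw [map_add, hts, ← add_assoc, add_comm (N.mod.d _), h, zero_add]

lemma isContractible_cone (M : CycleCat.{u, v, w} A) : IsContractible (cone (𝟙 M)) :=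
  isContractible_tw (N := M⟦(1 : ℤ)⟧) LinearMap.id ⟨fun _ _ => rfl, fun k l h x hx => by
    obtain rfl : k = l + 1 := by omega
    exact hx⟩ (fun _ => rfl) (fun _ => rfl)

/-- The splitting of the conflation `N ⟶ C(f) ⟶ M[1]`. -/
noncomputable def coneSplit (f : M ⟶ N) : GrSplit (coneInl f) (coneSnd f) :=
  GrSplit.twist N (M⟦(1 : ℤ)⟧) _ _ _

/-- `M` is a quotient of the contractible module `M[-1] ⊕ M`. -/
lemma exists_contractible_deflation (M : CycleCat.{u, v, w} A) :
    ∃ (P : CycleCat.{u, v, w} A) (p : P ⟶ M), IsContractible P ∧ IsDeflation (semiSplit A) p := by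
  -- The cocycle is the identity of the underlying module, read as a map `M → M[-1]` of degree 1. It
  -- satisfies the cocycle condition because the differential of `M[-1]` is `-d`.
  let s : M.mod.carrier →ₗ[K] (M⟦(-1 : ℤ)⟧).mod.carrier := LinearMap.id (M := M.mod.carrier)
  have hs : s ∈ M.mod.toGrMod.HOM (M⟦(-1 : ℤ)⟧).mod.toGrMod 1 :=
      ⟨fun _ _ => rfl, fun k l h x hx => by
    obtain rfl : l = k + 1 := by omega
    change x ∈ M.mod.gr (k + 1 + -1)
    rwa [add_neg_cancel_right]⟩
  have hd : ∀ x : M.mod.carrier, (M⟦(-1 : ℤ)⟧).mod.d (s x) + s (M.mod.d x) = 0 :=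
    fun x => by
      change (-1 : ℤ).negOnePow • M.mod.d x + M.mod.d x = 0
      simp [Units.smul_def]
  refine ⟨tw (M⟦(-1 : ℤ)⟧) M s hs hd, twistSnd _ _ _ hs hd,
    isContractible_tw (LinearMap.id (M := M.mod.carrier)) ⟨fun _ _ => rfl, fun k l h x hx => ?_⟩
      (fun _ => rfl) (fun _ => rfl), (isDeflation_iff _).2 ⟨_, _, ⟨GrSplit.twist _ _ _ hs hd⟩⟩⟩
  obtain rfl : l = k + -1 := h.symm
  exact hx

/-- Extending the identity along `P ⟶ C(1_P)` makes `P` a retract of a contractible module. -/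
lemma isContractible_of_isRelInjective (hP : IsRelInjective (semiSplit A) P) :
    IsContractible P := by
  obtain ⟨g, hg⟩ := hP _ (coneSplit (𝟙 P)).semiSplit (𝟙 P)
  exact (isContractible_cone P).of_retract _ g hg

/-- Lifting the identity through a deflation from a contractible module makes `P` a retract of it.
-/
lemma isContractible_of_isRelProjective (hP : IsRelProjective (semiSplit A) P) :
    IsContractible P := by
  obtain ⟨Q, p, hQ, X, i, h, hS⟩ := exists_contractible_deflation P
  obtain ⟨g, hg⟩ := hP _ hS (𝟙 P)
  exact hQ.of_retract g p hg

end

variable (A) in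
lemma isFrobeniusExact_semiSplit : IsFrobeniusExact (semiSplit.{u, v, w} A) where
  toIsExactStructure := isExactStructure_semiSplit
  enoughProjectives X := by
    obtain ⟨P, p, hP, hp⟩ := exists_contractible_deflation X
    exact ⟨P, p, hP.isRelProjective, hp⟩
  enoughInjectives X := ⟨_, _, (isContractible_cone X).isRelInjective,
    (isInflation_iff _).2 ⟨_, _, ⟨coneSplit (𝟙 X)⟩⟩⟩
  projective_iff_injective X :=
    ⟨fun h => (isContractible_of_isRelProjective h).isRelInjective,
      fun h => (isContractible_of_isRelInjective h).isRelProjective⟩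

/-! ### Stable equality is homotopy; comparison with `H⁰(Dg-A)` -/

variable (A) in
/-- Two morphisms of `C(A)` are stably equal if and only if they are homotopic. -/
lemma stableRel_eq_boundaryRel :
    stableRel (semiSplit.{u, v, w} A) = DGCategory.boundaryRel K (DGMod.{u, v, w} A) := by
  funext M N f g
  refine propext ((Iff.trans ?_ (boundaryRel_iff f g).symm))
  constructor
  -- A contraction `σ` of `P` gives the homotopy `b σ a`.
  · rintro ⟨P, a, b, hP, h⟩
    obtain ⟨σ, hσ, e⟩ := isContractible_of_isRelProjective hP
    refine ⟨app b ∘ₗ σ ∘ₗ app a, HOM_comp (add_zero (-1)) (HOM_comp (zero_add (-1)) (app_mem a) hσ)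
      (app_mem b), fun x => ?_⟩
    change _ = N.mod.d (app b (σ (app a x))) + app b (σ (app a (M.mod.d x)))
    rw [← app_d, app_d a, ← map_add, ← e, ← app_comp, ← h, app_sub]
  -- The map `(f - g, σ)` on `C(1_M)` extends `f - g`. Since `M[1]` has differential `-d`, it
  -- commutes with the differentials exactly when `f - g = dσ + σd`.
  · rintro ⟨σ, hσ, e⟩
    refine ⟨cone (𝟙 M), coneInl (𝟙 M), twDesc (L := M) (N := M⟦(1 : ℤ)⟧) (f - g) σ
      ⟨hσ.1, fun k l h x hx => hσ.2 (k + 1) l (by omega) x hx⟩ fun (y : M.mod.carrier) => ?_,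
      (isContractible_cone M).isRelProjective, CycleCat.ext fun x => ?_⟩
    · change N.mod.d (σ y) = app (f - g) y + σ ((shift 1 M.mod).d y)
      have h : (shift 1 M.mod).d y = -M.mod.d y := neg_one_zsmul (M.mod.d y)
      rw [h, app_sub, e]
      exact ((congrArg (_ + ·) (map_neg σ _)).trans (add_neg_cancel_right _ _)).symm
    · change app (f - g) x = app (f - g) x + σ 0
      rw [map_zero, add_zero]

/-- Morphisms of `C(A)` become equal in `H(A)` if and only if they are homotopic. -/
lemma toHtpyCat_map_eq_iff {M N : CycleCat.{u, v, w} A} (f g : M ⟶ N) :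
    (toHtpyCat A).map f = (toHtpyCat A).map g ↔
      ∃ σ ∈ M.mod.toGrMod.HOM N.mod.toGrMod (-1),
        ∀ x, app f x - app g x = N.mod.d (σ x) + σ (M.mod.d x) := by
  rw [← boundaryRel_iff, ← stableRel_eq_boundaryRel]
  exact Quotient.functor_map_eq_iff (stableRel (semiSplit A)) f g

instance : (toHtpyCat.{u, v, w} A).Full := Quotient.full_functor _

lemma exists_eq_toHtpyCat_obj (X : HtpyCat.{u, v, w} A) : ∃ M, X = (toHtpyCat A).obj M :=
  ⟨X.as, rfl⟩

instance : (toHtpyCat.{u, v, w} A).Linear K :=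
  letI : Preadditive (Quotient (stableRel (semiSplit.{u, v, w} A))) :=
    Quotient.preadditive _ (stableRel_add _)
  haveI : (Quotient.functor (stableRel (semiSplit.{u, v, w} A))).Additive :=
    Quotient.functor_additive _ (stableRel_add _)
  Quotient.linear_functor K _ (stableRel_smul _)

instance : (DGCategory.toZeroHomology K (DGMod.{u, v, w} A)).Linear K :=
  letI : Preadditive (Quotient (DGCategory.boundaryRel K (DGMod.{u, v, w} A))) :=
    Quotient.preadditive _ (DGCategory.boundaryRel_add _ _)
  haveI : (Quotient.functor (DGCategory.boundaryRel K (DGMod.{u, v, w} A))).Additive :=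
    Quotient.functor_additive _ (DGCategory.boundaryRel_add _ _)
  Quotient.linear_functor K _ (DGCategory.boundaryRel_smul _ _)

instance : (DGCategory.toZeroHomology K (DGMod.{u, v, w} A)).Full := Quotient.full_functor _

lemma toZeroHomology_map_eq_iff {M N : CycleCat.{u, v, w} A} (f g : M ⟶ N) :
    (DGCategory.toZeroHomology K (DGMod.{u, v, w} A)).map f =
      (DGCategory.toZeroHomology K (DGMod.{u, v, w} A)).map g ↔
        (toHtpyCat A).map f = (toHtpyCat A).map g := by
  rw [toHtpyCat_map_eq_iff, ← boundaryRel_iff]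
  exact Quotient.functor_map_eq_iff (DGCategory.boundaryRel K (DGMod A)) f g

variable (A) in
/-- The functor `H(A) ⥤ H⁰(Dg-A)` induced by the identity of `C(A)`. -/
noncomputable def htpyToZeroHomology :
    HtpyCat.{u, v, w} A ⥤ DGCategory.ZeroHomology K (DGMod.{u, v, w} A) :=
  CategoryTheory.Quotient.lift (stableRel (semiSplit A)) (DGCategory.toZeroHomology K (DGMod A))
    fun _ _ f g h => (toZeroHomology_map_eq_iff f g).2 (CategoryTheory.Quotient.sound _ h)

variable (A) in
/-- The functor `H(A) ⥤ H⁰(Dg-A)` is compatible with the projections from `C(A)`. -/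
noncomputable def toHtpyCatCompIso :
    toHtpyCat.{u, v, w} A ⋙ htpyToZeroHomology A ≅ DGCategory.toZeroHomology K (DGMod A) :=
  CategoryTheory.Quotient.lift.isLift (stableRel (semiSplit A)) _ _

instance : (htpyToZeroHomology.{u, v, w} A).Linear K where
  map_smul {X Y} f r := by
    obtain ⟨M, rfl⟩ := exists_eq_toHtpyCat_obj X
    obtain ⟨N, rfl⟩ := exists_eq_toHtpyCat_obj Y
    obtain ⟨f, rfl⟩ := (toHtpyCat A).map_surjective f
    rw [← Functor.map_smul]
    exact (DGCategory.toZeroHomology K (DGMod A)).map_smul r f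

instance : (htpyToZeroHomology.{u, v, w} A).Additive where
  map_add {X Y f g} := by
    obtain ⟨M, rfl⟩ := exists_eq_toHtpyCat_obj X
    obtain ⟨N, rfl⟩ := exists_eq_toHtpyCat_obj Y
    obtain ⟨f, rfl⟩ := (toHtpyCat A).map_surjective f
    obtain ⟨g, rfl⟩ := (toHtpyCat A).map_surjective g
    rw [← Functor.map_add]
    exact (DGCategory.toZeroHomology K (DGMod A)).map_add

/-- Both sides are quotients of `C(A)` with unchanged objects and, by `toZeroHomology_map_eq_iff`,
the same identification of morphisms. -/
instance : (htpyToZeroHomology.{u, v, w} A).IsEquivalence where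
  faithful := ⟨fun {X Y f g} h => by
    obtain ⟨M, rfl⟩ := exists_eq_toHtpyCat_obj X
    obtain ⟨N, rfl⟩ := exists_eq_toHtpyCat_obj Y
    obtain ⟨f, rfl⟩ := (toHtpyCat A).map_surjective f
    obtain ⟨g, rfl⟩ := (toHtpyCat A).map_surjective g
    exact (toZeroHomology_map_eq_iff f g).1 h⟩
  full := ⟨fun {X Y} f => by
    obtain ⟨M, rfl⟩ := exists_eq_toHtpyCat_obj X
    obtain ⟨N, rfl⟩ := exists_eq_toHtpyCat_obj Y
    obtain ⟨f, hf⟩ := (DGCategory.toZeroHomology K (DGMod A)).map_surjective (X := M) (Y := N) f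
    exact ⟨(toHtpyCat A).map f, hf⟩⟩
  essSurj := ⟨fun N => ⟨(toHtpyCat A).obj N.as, ⟨eqToIso rfl⟩⟩⟩

instance (n : ℤ) : (shiftFunctor (CycleCat.{u, v, w} A) n).Linear K where
  map_smul _ _ := rfl

lemma toHtpyCat_map_shift {M N : CycleCat.{u, v, w} A} (f : M ⟶ N) (n : ℤ) :
    ((toHtpyCat A).map f)⟦n⟧' = ((toHtpyCat A).commShiftIso n).inv.app M ≫
      (toHtpyCat A).map (f⟦n⟧') ≫ ((toHtpyCat A).commShiftIso n).hom.app N := by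
  rw [Functor.commShiftIso_hom_naturality, Iso.inv_hom_id_app_assoc]

instance (n : ℤ) : (shiftFunctor (HtpyCat.{u, v, w} A) n).Linear K where
  map_smul {X Y} f r := by
    obtain ⟨M, rfl⟩ := exists_eq_toHtpyCat_obj X
    obtain ⟨N, rfl⟩ := exists_eq_toHtpyCat_obj Y
    obtain ⟨f, rfl⟩ := (toHtpyCat A).map_surjective f
    rw [← Functor.map_smul, toHtpyCat_map_shift, toHtpyCat_map_shift, Functor.map_smul,
      Functor.map_smul, Linear.smul_comp, Linear.comp_smul]

/-! ### Standard triangles and triangles of conflations -/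

open Pretriangulated

lemma shift_one_d (M : DGMod.{u, v, w} A) (x : M.carrier) : (shift 1 M).d x = -M.d x :=
  neg_one_zsmul (M.d x)

lemma cone_d {M N : CycleCat.{u, v, w} A} (f : M ⟶ N) (x : N.mod.carrier × M.mod.carrier) :
    (cone f).mod.d x = (N.mod.d x.1 + app f x.2, -M.mod.d x.2) :=
  Prod.ext rfl (shift_one_d M.mod x.2)

/-- Morphisms of `C(A)` which are inverse up to homotopy define an isomorphism in `H(A)`. -/
noncomputable def htpyIso {M N : CycleCat.{u, v, w} A} (φ : M ⟶ N) (ψ : N ⟶ M)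
    (h : (toHtpyCat A).map (φ ≫ ψ) = (toHtpyCat A).map (𝟙 M)) (h' : ψ ≫ φ = 𝟙 N) :
    (toHtpyCat A).obj M ≅ (toHtpyCat A).obj N where
  hom := (toHtpyCat A).map φ
  inv := (toHtpyCat A).map ψ
  hom_inv_id := by rw [← Functor.map_comp, h, CategoryTheory.Functor.map_id]
  inv_hom_id := by rw [← Functor.map_comp, h', CategoryTheory.Functor.map_id]

/-- The standard triangle `M ⟶ N ⟶ C(f) ⟶ M[1]`. -/
noncomputable abbrev coneTriangle {M N : CycleCat.{u, v, w} A} (f : M ⟶ N) :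
    Triangle (CycleCat.{u, v, w} A) :=
  Triangle.mk f (coneInl f) (coneSnd f)

variable (A) in
/-- The triangles of `H(A)` which are isomorphic to the image of a standard triangle. -/
def distTriangles : Set (Triangle (HtpyCat.{u, v, w} A)) := fun T =>
  ∃ (M N : CycleCat.{u, v, w} A) (f : M ⟶ N),
    Nonempty (T ≅ (toHtpyCat A).mapTriangle.obj (coneTriangle f))

lemma distTriangles_of_iso {T T' : Triangle (HtpyCat.{u, v, w} A)} (hT : T ∈ distTriangles A)
    (e : T' ≅ T) : T' ∈ distTriangles A := by
  obtain ⟨M, N, f, ⟨e'⟩⟩ := hT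
  exact ⟨M, N, f, ⟨e ≪≫ e'⟩⟩

/-- A triangle in `C(A)` whose third object is homotopy equivalent to the cone of the first
morphism, compatibly with the other morphisms, is distinguished in `H(A)`. -/
lemma mem_distTriangles_of_cone (T : Triangle (CycleCat.{u, v, w} A)) (φ : cone T.mor₁ ⟶ T.obj₃)
    (ψ : T.obj₃ ⟶ cone T.mor₁)
    (h : (toHtpyCat A).map (φ ≫ ψ) = (toHtpyCat A).map (𝟙 (cone T.mor₁))) (h' : ψ ≫ φ = 𝟙 T.obj₃)
    (h₂ : coneInl T.mor₁ ≫ φ = T.mor₂) (h₃ : ψ ≫ coneSnd T.mor₁ = T.mor₃) :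
    (toHtpyCat A).mapTriangle.obj T ∈ distTriangles A := by
  refine ⟨_, _, T.mor₁, ⟨Triangle.isoMk _ _ (Iso.refl _) (Iso.refl _) (htpyIso φ ψ h h').symm
    ?_ ?_ ?_⟩⟩
  · exact (Category.comp_id _).trans (Category.id_comp _).symm
  · refine Eq.trans ?_ (Category.id_comp _).symm
    change (toHtpyCat A).map T.mor₂ ≫ (toHtpyCat A).map ψ = (toHtpyCat A).map (coneInl T.mor₁)
    rw [← h₂, ← Functor.map_comp, Category.assoc, Functor.map_comp, h, ← Functor.map_comp,
      Category.comp_id]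
  · change ((toHtpyCat A).map T.mor₃ ≫ ((toHtpyCat A).commShiftIso (1 : ℤ)).hom.app T.obj₁) ≫
      (𝟙 ((toHtpyCat A).obj T.obj₁))⟦(1 : ℤ)⟧' = (toHtpyCat A).map ψ ≫
        (toHtpyCat A).map (coneSnd T.mor₁) ≫ ((toHtpyCat A).commShiftIso (1 : ℤ)).hom.app T.obj₁
    rw [← h₃, CategoryTheory.Functor.map_id]
    exact (Category.comp_id _).trans (by rw [Functor.map_comp, Category.assoc])

/-- A homotopy commutative square induces a morphism between the cones. -/
noncomputable def coneMap {M N M' N' : CycleCat.{u, v, w} A} (f : M ⟶ N) (f' : M' ⟶ N') (a : M ⟶ M')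
    (b : N ⟶ N') (σ : M.mod.carrier →ₗ[K] N'.mod.carrier)
    (hσ : σ ∈ M.mod.toGrMod.HOM N'.mod.toGrMod (-1))
    (h : ∀ x, app (f ≫ b) x - app (a ≫ f') x = N'.mod.d (σ x) + σ (M.mod.d x)) :
    cone f ⟶ cone f' :=
  -- The matrix is `(b, σ; 0, a)`; the entry `σ` makes up for the failure of the square to commute
  -- strictly.
  twDesc (L := N) (N := M⟦(1 : ℤ)⟧) (b ≫ coneInl f')
    (σ.prod (app (M := M) (N := M') a))
    ⟨fun x c => Prod.ext (hσ.1 x c) ((app_mem a).1 x c), fun k l hkl x hx =>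
      ⟨hσ.2 (k + 1) l (by omega) x hx, (app_mem a).2 (k + 1) (l + 1) (by omega) x hx⟩⟩
    fun (x : M.mod.carrier) => by
      refine (cone_d f' (σ x, app a x)).trans (Prod.ext ?_ ?_)
      · change N'.mod.d (σ x) + app f' (app a x) =
          app b (app f x) + σ ((shift 1 M.mod).d x)
        rw [shift_one_d, map_neg, ← app_comp, ← app_comp, ← sub_eq_add_neg, eq_sub_iff_add_eq,
          add_right_comm, ← h x, sub_add_cancel]
      · change -M'.mod.d (app a x) = 0 + app a ((shift 1 M.mod).d x)
        rw [shift_one_d, map_neg, zero_add, app_d]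

section

variable {M N M' N' : CycleCat.{u, v, w} A} {f : M ⟶ N} {f' : M' ⟶ N'} {a : M ⟶ M'} {b : N ⟶ N'}
  {σ : M.mod.carrier →ₗ[K] N'.mod.carrier} {hσ : σ ∈ M.mod.toGrMod.HOM N'.mod.toGrMod (-1)}
  {h : ∀ x, app (f ≫ b) x - app (a ≫ f') x = N'.mod.d (σ x) + σ (M.mod.d x)}

lemma coneInl_coneMap : coneInl f ≫ coneMap f f' a b σ hσ h = b ≫ coneInl f' :=
  CycleCat.ext fun x => Prod.ext
    (show app b x + σ 0 = app b x by rw [map_zero, add_zero])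
    (show 0 + app a 0 = (0 : M'.mod.carrier) by rw [map_zero, add_zero])

lemma coneMap_coneSnd : coneMap f f' a b σ hσ h ≫ coneSnd f' = coneSnd f ≫ a⟦(1 : ℤ)⟧' :=
  CycleCat.ext fun x => zero_add (app (M := M) (N := M') a x.2)

end

/-- The morphism of triangles of `H(A)` induced by a homotopy commutative square. -/
lemma exists_coneTriangle_hom {M N M' N' : CycleCat.{u, v, w} A} (f : M ⟶ N) (f' : M' ⟶ N')
    (a : (toHtpyCat A).obj M ⟶ (toHtpyCat A).obj M')
    (b : (toHtpyCat A).obj N ⟶ (toHtpyCat A).obj N')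
    (h : (toHtpyCat A).map f ≫ b = a ≫ (toHtpyCat A).map f') :
    ∃ φ : (toHtpyCat A).mapTriangle.obj (coneTriangle f) ⟶
      (toHtpyCat A).mapTriangle.obj (coneTriangle f'), φ.hom₁ = a ∧ φ.hom₂ = b := by
  obtain ⟨a, rfl⟩ := (toHtpyCat A).map_surjective a
  obtain ⟨b, rfl⟩ := (toHtpyCat A).map_surjective b
  have h' := h
  rw [← Functor.map_comp, ← Functor.map_comp, toHtpyCat_map_eq_iff] at h'
  -- Commutativity in `H(A)` only provides some homotopy between the lifted composites. Any choice
  -- yields a map of cones, which accounts for the lack of uniqueness of the third component.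
  obtain ⟨σ, hσ, e⟩ := h'
  refine ⟨Triangle.homMk _ _ ((toHtpyCat A).map a) ((toHtpyCat A).map b)
    ((toHtpyCat A).map (coneMap f f' a b σ hσ e)) h ?_ ?_, rfl, rfl⟩
  · change (toHtpyCat A).map (coneInl f) ≫ (toHtpyCat A).map (coneMap f f' a b σ hσ e) =
      (toHtpyCat A).map b ≫ (toHtpyCat A).map (coneInl f')
    rw [← Functor.map_comp, coneInl_coneMap, Functor.map_comp]
  · change ((toHtpyCat A).map (coneSnd f) ≫ ((toHtpyCat A).commShiftIso (1 : ℤ)).hom.app M) ≫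
      ((toHtpyCat A).map a)⟦(1 : ℤ)⟧' = (toHtpyCat A).map (coneMap f f' a b σ hσ e) ≫
        (toHtpyCat A).map (coneSnd f') ≫ ((toHtpyCat A).commShiftIso (1 : ℤ)).hom.app M'
    rw [Category.assoc, ← Functor.commShiftIso_hom_naturality, ← Functor.map_comp_assoc,
      ← Functor.map_comp_assoc, coneMap_coneSnd]

/-- Conjugating by the isomorphisms to standard triangles reduces this to `exists_coneTriangle_hom`.
-/
lemma distTriangles_complete (T₁ T₂ : Triangle (HtpyCat.{u, v, w} A)) (h₁ : T₁ ∈ distTriangles A)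
    (h₂ : T₂ ∈ distTriangles A) (a : T₁.obj₁ ⟶ T₂.obj₁) (b : T₁.obj₂ ⟶ T₂.obj₂)
    (h : T₁.mor₁ ≫ b = a ≫ T₂.mor₁) :
    ∃ c : T₁.obj₃ ⟶ T₂.obj₃, T₁.mor₂ ≫ c = b ≫ T₂.mor₂ ∧ T₁.mor₃ ≫ a⟦1⟧' = c ≫ T₂.mor₃ := by
  obtain ⟨M, N, f, ⟨e⟩⟩ := h₁
  obtain ⟨M', N', f', ⟨e'⟩⟩ := h₂
  have h' : ((toHtpyCat A).mapTriangle.obj (coneTriangle f)).mor₁ ≫ e.inv.hom₂ ≫ b ≫ e'.hom.hom₂ =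
      (e.inv.hom₁ ≫ a ≫ e'.hom.hom₁) ≫ ((toHtpyCat A).mapTriangle.obj (coneTriangle f')).mor₁ := by
    rw [e.inv.comm₁_assoc, reassoc_of% h, e'.hom.comm₁, Category.assoc, Category.assoc]
  obtain ⟨φ, hφ₁, hφ₂⟩ : ∃ φ : (toHtpyCat A).mapTriangle.obj (coneTriangle f) ⟶
      (toHtpyCat A).mapTriangle.obj (coneTriangle f'),
      φ.hom₁ = e.inv.hom₁ ≫ a ≫ e'.hom.hom₁ ∧ φ.hom₂ = e.inv.hom₂ ≫ b ≫ e'.hom.hom₂ :=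
    exists_coneTriangle_hom f f' _ _ h'
  have ha : (e.hom ≫ φ ≫ e'.inv).hom₁ = a := by
    change e.hom.hom₁ ≫ φ.hom₁ ≫ e'.inv.hom₁ = a
    rw [hφ₁]
    simp only [Category.assoc, Iso.hom_inv_id_triangle_hom₁_assoc, Iso.hom_inv_id_triangle_hom₁,
      Category.comp_id]
  have hb : (e.hom ≫ φ ≫ e'.inv).hom₂ = b := by
    change e.hom.hom₂ ≫ φ.hom₂ ≫ e'.inv.hom₂ = b
    rw [hφ₂]
    simp only [Category.assoc, Iso.hom_inv_id_triangle_hom₂_assoc, Iso.hom_inv_id_triangle_hom₂,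
      Category.comp_id]
  refine ⟨(e.hom ≫ φ ≫ e'.inv).hom₃, ?_, ?_⟩
  · rw [(e.hom ≫ φ ≫ e'.inv).comm₂, hb]
  · rw [← (e.hom ≫ φ ≫ e'.inv).comm₃, ha]

/-- The triangles of conflations are distinguished. -/
lemma mem_distTriangles_of_grSplit {L M N : CycleCat.{u, v, w} A} {u : L ⟶ M} {v : M ⟶ N}
    (h : GrSplit u v) (g : M ⟶ cone (𝟙 L)) (w : N ⟶ L⟦(1 : ℤ)⟧) (hg : u ≫ g = coneInl (𝟙 L))
    (hw : v ≫ w = g ≫ coneSnd (𝟙 L)) :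
    (toHtpyCat A).mapTriangle.obj (Triangle.mk u v (-w)) ∈ distTriangles A := by
  -- `g` provides a graded retraction `r` of `u` for which `w` is the cocycle of the conflation.
  let r : M.mod.carrier →ₗ[K] L.mod.carrier := LinearMap.fst K _ _ ∘ₗ app g
  have hr : r ∈ M.mod.toGrMod.HOM L.mod.toGrMod 0 :=
    HOM_comp (add_zero 0) (app_mem g) (coneSplit (𝟙 L)).r_mem
  have hru (x : L.mod.carrier) : r (app u x) = x :=
    congrArg Prod.fst (LinearMap.congr_fun (congrArg app hg) x)
  have hvu : ∀ x, app v (app u x) = 0 := h.p_i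
  -- The retraction `r` read off from `g` need not be `h.r`, so the section is corrected by `u r` in
  -- order that `r s = 0`.
  let s : N.mod.carrier →ₗ[K] M.mod.carrier := h.s - app u ∘ₗ r ∘ₗ h.s
  have hs : s ∈ N.mod.toGrMod.HOM M.mod.toGrMod 0 :=
    sub_mem h.s_mem (HOM_comp (add_zero 0) (HOM_comp (add_zero 0) h.s_mem hr) (app_mem u))
  have hvs (x : N.mod.carrier) : app v (s x) = x := by
    change app v (h.s x - app u (r (h.s x))) = x
    rw [map_sub, hvu, sub_zero]
    exact h.p_s x
  have hsv (x : M.mod.carrier) : s (app v x) = x - app u (r x) := by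
    have e : h.s (app v x) = x - app u (h.r x) := eq_sub_of_add_eq' (h.total x)
    change h.s (app v x) - app u (r (h.s (app v x))) = _
    rw [e, map_sub, hru, map_sub]
    abel
  let ω : N.mod.carrier →ₗ[K] L.mod.carrier := app (N := L⟦(1 : ℤ)⟧) w
  have hrd (x : M.mod.carrier) : r (M.mod.d x) = L.mod.d (r x) + ω (app v x) := by
    have e₁ : ω (app v x) = (app g x).2 := LinearMap.congr_fun (congrArg app hw) x
    rw [e₁]
    exact congrArg Prod.fst (app_d g x)
  have hdu (x : N.mod.carrier) : app u (ω x) = M.mod.d (s x) - s (N.mod.d x) := by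
    have e₁ := hsv (M.mod.d (s x))
    have e₂ : r (s x) = 0 := by
      change r (h.s x - app u (r (h.s x))) = 0
      rw [map_sub, hru, sub_self]
    rw [app_d, hvs, hrd, hvs, e₂, map_zero, zero_add] at e₁
    rw [e₁, sub_sub_cancel]
  -- The equivalence is `φ = (v, 0)` with inverse `ψ = (s, -w)`. By `hdu`, `u ω = d s - s d`, so `ψ`
  -- commutes with the differentials only with the sign `-w`; this is where the sign of the third
  -- morphism comes from.
  let φ : cone u ⟶ N := twDesc (L := M) (N := L⟦(1 : ℤ)⟧) v 0 (zero_mem _) fun x => by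
    change N.mod.d 0 = app v (app u x) + 0
    rw [map_zero, add_zero]
    exact (hvu x).symm
  let ψ : N ⟶ cone u := twLift (L := M) (N := L⟦(1 : ℤ)⟧) s hs (-w) fun x => by
    change s (N.mod.d x) = M.mod.d (s x) + app u (-ω x)
    rw [map_neg, hdu]
    abel
  refine mem_distTriangles_of_cone (Triangle.mk u v (-w)) φ ψ ?_
    (CycleCat.ext fun (x : N.mod.carrier) => (add_zero (app v (s x))).trans (hvs x))
    (CycleCat.ext fun (x : M.mod.carrier) => add_zero (app v x)) (CycleCat.ext fun x => rfl)
  rw [toHtpyCat_map_eq_iff]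
  -- The homotopy between `ψ φ` and the identity of `C(u)` is `(x, y) ↦ (0, -r x)`.
  refine ⟨-(LinearMap.inr K M.mod.carrier L.mod.carrier ∘ₗ r ∘ₗ LinearMap.fst K _ _),
    neg_mem ⟨fun x a => Prod.ext ?_ (hr.1 x.1 a), fun k l hkl x hx => ⟨zero_mem _,
      hr.2 k (l + 1) (by omega) x.1 hx.1⟩⟩,
    fun (x : M.mod.carrier × L.mod.carrier) => Prod.ext ?_ ?_⟩
  · change (0 : M.mod.carrier) = M.mod.act 0 a
    rw [map_zero, LinearMap.zero_apply]
  · change s (app v x.1 + 0) - x.1 = M.mod.d (-0) + app u (-r x.1) + -0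
    rw [add_zero, hsv, map_neg, neg_zero, map_zero, neg_zero, zero_add, map_neg,
      sub_sub_cancel_left, add_zero]
  · let D : L.mod.carrier →ₗ[K] L.mod.carrier := (shift 1 L.mod).d
    have hD (y) : D y = -L.mod.d y := shift_one_d L.mod y
    change -ω (app v x.1 + 0) - x.2 =
      D (-r x.1) + -r (M.mod.d x.1 + app u x.2)
    rw [hD, map_neg, neg_neg, add_zero, map_add r, hru, hrd]
    abel

lemma mem_distTriangles_of_isConflationTriangle {T : Triangle (CycleCat.{u, v, w} A)}
    (hT : IsConflationTriangle T) : (toHtpyCat A).mapTriangle.obj T ∈ distTriangles A := by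
  obtain ⟨_, hS, g, w, hg, hw, hm⟩ := hT
  obtain ⟨h⟩ := GrSplit.of_semiSplit hS
  have e : T = Triangle.mk T.mor₁ T.mor₂ (-w) := by rw [← hm]; rfl
  rw [e]
  exact mem_distTriangles_of_grSplit h g w hg hw

/-- The rotation of a standard triangle comes from a conflation. -/
lemma isConflationTriangle_rotate {M N : CycleCat.{u, v, w} A} (f : M ⟶ N) :
    IsConflationTriangle (coneTriangle f).rotate := by
  refine ⟨coneInl_coneSnd f, (coneSplit f).semiSplit,
    -- Here `g` is `(x, y) ↦ (x, f y)`, lying over `w = f[1]`. Rotation gives the third morphism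
    -- `-f[1]`, which matches the required `-w`.
    twDesc (L := N) (N := M⟦(1 : ℤ)⟧) (coneInl (𝟙 N))
      (LinearMap.inr K N.mod.carrier N.mod.carrier ∘ₗ app (M := M) (N := N) f)
      ⟨fun x a => Prod.ext ?_ ((app_mem f).1 x a), fun k l hkl x hx =>
        ⟨zero_mem _, (app_mem f).2 (k + 1) (l + 1) (by omega) x hx⟩⟩
      fun (x : M.mod.carrier) => (cone_d (𝟙 N) (0, app f x)).trans (Prod.ext ?_ ?_),
    f⟦(1 : ℤ)⟧', CycleCat.ext fun (x : N.mod.carrier) => Prod.ext ?_ ?_,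
    CycleCat.ext fun (x : N.mod.carrier × M.mod.carrier) => (zero_add (app f x.2)).symm, rfl⟩
  · change (0 : N.mod.carrier) = N.mod.act 0 a
    rw [map_zero, LinearMap.zero_apply]
  · change N.mod.d 0 + app f x = app f x + 0
    rw [map_zero, zero_add, add_zero]
  · change -N.mod.d (app f x) = 0 + app f ((shift 1 M.mod).d x)
    rw [shift_one_d, map_neg, zero_add, app_d]
  · exact add_zero x
  · change 0 + app f 0 = (0 : N.mod.carrier)
    rw [map_zero, zero_add]

lemma distTriangles_rotate (T : Triangle (HtpyCat.{u, v, w} A)) (hT : T ∈ distTriangles A) :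
    T.rotate ∈ distTriangles A := by
  obtain ⟨M, N, f, ⟨e⟩⟩ := hT
  exact distTriangles_of_iso
    (mem_distTriangles_of_isConflationTriangle (isConflationTriangle_rotate f))
    ((rotate _).mapIso e ≪≫ (toHtpyCat A).mapTriangleRotateIso.app (coneTriangle f))

/-! ### Inverse rotation -/

section InverseRotation

variable {M N : CycleCat.{u, v, w} A} (f : M ⟶ N)

lemma shift_neg_one_d (M : DGMod.{u, v, w} A) (x : M.carrier) : (shift (-1) M).d x = -M.d x :=
  neg_one_zsmul (M.d x)

/-- The negative of the canonical morphism `C(f)[-1] ⟶ M`. -/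
noncomputable def coneShiftDesc : (cone f)⟦(-1 : ℤ)⟧ ⟶ M :=
  CycleCat.mk (M := shift (-1) (cone f).mod) (N := M.mod)
    -- The sign cancels the one that rotation puts on the third morphism, so that the rotated
    -- triangle ends in `coneSnd f` up to `coneShiftIso`.
    (-LinearMap.snd K N.mod.carrier M.mod.carrier)
    (neg_mem ⟨fun _ _ => rfl, fun k l h (x : N.mod.carrier × M.mod.carrier) hx => by
      have hx₂ : x.2 ∈ M.mod.gr (k + -1 + 1) := hx.2
      rwa [show k + -1 + 1 = l by omega] at hx₂⟩)
    fun (x : N.mod.carrier × M.mod.carrier) => by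
      refine (congrArg (-LinearMap.snd K N.mod.carrier M.mod.carrier)
        ((shift_neg_one_d (cone f).mod x).trans (congrArg Neg.neg (cone_d f x)))).trans ?_
      change -(- -M.mod.d x.2) = M.mod.d (-x.2)
      rw [neg_neg, map_neg]

/-- The identification of `C(f)` with `C(f)[-1][1]`. -/
noncomputable def coneShiftIso : cone f ≅ (cone f)⟦(-1 : ℤ)⟧⟦(1 : ℤ)⟧ :=
  CycleCat.mkIso (M := (cone f).mod) (N := shift 1 (shift (-1) (cone f).mod))
    LinearMap.id LinearMap.id
    ⟨fun _ _ => rfl, fun k l h x hx => by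
      obtain rfl : k = l + 1 + -1 := by omega
      exact hx⟩
    ⟨fun _ _ => rfl, fun k l h x hx => by
      obtain rfl : l = k + 1 + -1 := by omega
      exact hx⟩
    (fun x => by
      refine Eq.trans ?_ (shift_one_d (shift (-1) (cone f).mod) x).symm
      refine (neg_neg ((cone f).mod.d x)).symm.trans (congrArg Neg.neg ?_)
      exact (shift_neg_one_d (cone f).mod x).symm)
    (fun _ => rfl) fun _ => rfl

/-- The homotopy equivalence from the cone of `C(f)[-1] ⟶ M` to `N`. -/
noncomputable def coneConeShiftDesc : cone (coneShiftDesc f) ⟶ N :=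
  -- This is `(m, (n, m')) ↦ f m + n`, with strict section `n ↦ (0, (n, 0))`.
  twDesc (L := M) (N := (cone f)⟦(-1 : ℤ)⟧⟦(1 : ℤ)⟧) f (LinearMap.fst K N.mod.carrier M.mod.carrier)
    ⟨fun _ _ => rfl, fun k l h (x : N.mod.carrier × M.mod.carrier) hx => by
      have hx₁ : x.1 ∈ N.mod.gr (k + 1 + -1) := hx.1
      rwa [show k + 1 + -1 = l by omega] at hx₁⟩
    fun (x : N.mod.carrier × M.mod.carrier) => by
      have e := (app_d (coneShiftIso f).hom x).symm.trans (cone_d f x)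
      refine Eq.trans ?_ (congrArg (app f (-x.2) + ·) (congrArg Prod.fst e).symm)
      change N.mod.d x.1 = app f (-x.2) + (N.mod.d x.1 + app f x.2)
      rw [map_neg]
      abel

/-- The homotopy equivalence from `N` to the cone of `C(f)[-1] ⟶ M`. -/
noncomputable def coneConeShiftLift : N ⟶ cone (coneShiftDesc f) :=
  twLift (L := M) (N := (cone f)⟦(-1 : ℤ)⟧⟦(1 : ℤ)⟧) 0 (zero_mem _)
    (coneInl f ≫ (coneShiftIso f).hom) fun x => by
      change (0 : M.mod.carrier) = M.mod.d 0 + -0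
      rw [map_zero, neg_zero, add_zero]

lemma coneConeShift_htpy :
    (toHtpyCat A).map (coneConeShiftDesc f ≫ coneConeShiftLift f) = (toHtpyCat A).map (𝟙 _) := by
  rw [toHtpyCat_map_eq_iff]
  -- The homotopy `(m, (n, m')) ↦ (0, (0, m))` cancels the two copies of `M`, which the differential
  -- of the cone links by the component `m' ↦ -m'`.
  refine ⟨LinearMap.inr K M.mod.carrier (N.mod.carrier × M.mod.carrier) ∘ₗ
      LinearMap.inr K N.mod.carrier M.mod.carrier ∘ₗ LinearMap.fst K _ _,
    ⟨fun x a => Prod.ext ?_ (Prod.ext ?_ rfl), fun k l hkl x hx =>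
      ⟨zero_mem _, zero_mem _, ?_⟩⟩,
    fun (x : M.mod.carrier × N.mod.carrier × M.mod.carrier) => ?_⟩
  · change (0 : M.mod.carrier) = M.mod.act 0 a
    rw [map_zero, LinearMap.zero_apply]
  · change (0 : N.mod.carrier) = N.mod.act 0 a
    rw [map_zero, LinearMap.zero_apply]
  · have hx₁ : x.1 ∈ M.mod.gr k := hx.1
    obtain rfl : k = l + 1 + -1 + 1 := by omega
    exact hx₁
  · have e (y : N.mod.carrier × M.mod.carrier) :
        (shift 1 (shift (-1) (cone f).mod)).d y = (N.mod.d y.1 + app f y.2, -M.mod.d y.2) :=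
      (app_d (coneShiftIso f).hom y).symm.trans (cone_d f y)
    refine Prod.ext ?_ (Eq.trans ?_ (congrArg (· + ((0, M.mod.d x.1 + -x.2.2) :
      N.mod.carrier × M.mod.carrier)) (e (0, x.1))).symm)
    · change 0 - x.1 = M.mod.d 0 + -x.1 + 0
      rw [map_zero, zero_add, add_zero, zero_sub]
    · refine Prod.ext ?_ ?_
      · change app f x.1 + x.2.1 - x.2.1 = N.mod.d 0 + app f x.1 + 0
        rw [map_zero, zero_add, add_zero, add_sub_cancel_right]
      · change 0 - x.2.2 = -M.mod.d x.1 + (M.mod.d x.1 + -x.2.2)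
        rw [neg_add_cancel_left, zero_sub]

/-- A standard triangle is the rotation of a standard triangle. -/
lemma exists_iso_rotate_coneTriangle :
    Nonempty ((toHtpyCat A).mapTriangle.obj (coneTriangle f) ≅
      (toHtpyCat A).mapTriangle.obj (coneTriangle (coneShiftDesc f)).rotate) := by
  have h : coneConeShiftLift f ≫ coneConeShiftDesc f = 𝟙 N :=
    CycleCat.ext fun (x : N.mod.carrier) => by
      change app f 0 + x = x
      rw [map_zero, zero_add]
  have hf : coneInl (coneShiftDesc f) ≫ coneConeShiftDesc f = f :=
    CycleCat.ext fun (x : M.mod.carrier) => add_zero (app f x)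
  refine ⟨Triangle.isoMk _ _ (Iso.refl _) (htpyIso _ _ (coneConeShift_htpy f) h).symm
    ((toHtpyCat A).mapIso (coneShiftIso f)) ?_ ?_ ?_⟩
  · refine Eq.trans ?_ (Category.id_comp _).symm
    change (toHtpyCat A).map f ≫ (toHtpyCat A).map (coneConeShiftLift f) =
      (toHtpyCat A).map (coneInl (coneShiftDesc f))
    have e : f ≫ coneConeShiftLift f =
        coneInl (coneShiftDesc f) ≫ coneConeShiftDesc f ≫ coneConeShiftLift f := by
      rw [← Category.assoc, hf]
    rw [← Functor.map_comp, e, Functor.map_comp, coneConeShift_htpy, ← Functor.map_comp,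
      Category.comp_id]
  · change (toHtpyCat A).map (coneInl f) ≫ (toHtpyCat A).map (coneShiftIso f).hom =
      (toHtpyCat A).map (coneConeShiftLift f) ≫ (toHtpyCat A).map (coneSnd (coneShiftDesc f))
    rw [← Functor.map_comp, ← Functor.map_comp]
    rfl
  · have e : coneSnd f = (coneShiftIso f).hom ≫ (-(coneShiftDesc f)⟦(1 : ℤ)⟧') :=
      CycleCat.ext fun (x : N.mod.carrier × M.mod.carrier) => (neg_neg x.2).symm
    change ((toHtpyCat A).map (coneSnd f) ≫ ((toHtpyCat A).commShiftIso (1 : ℤ)).hom.app M) ≫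
      (𝟙 ((toHtpyCat A).obj M))⟦(1 : ℤ)⟧' = (toHtpyCat A).map (coneShiftIso f).hom ≫
        (toHtpyCat A).map (-(coneShiftDesc f)⟦(1 : ℤ)⟧') ≫
          ((toHtpyCat A).commShiftIso (1 : ℤ)).hom.app M
    rw [e, CategoryTheory.Functor.map_id]
    exact (Category.comp_id _).trans (by rw [Functor.map_comp, Category.assoc])

end InverseRotation

/-! ### The pretriangulated structure -/

/-- Rotation is an equivalence on triangles, so an isomorphism from `T.rotate` to the rotation of a
standard triangle, provided by `exists_iso_rotate_coneTriangle`, descends to `T`. -/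
lemma distTriangles_of_rotate (T : Triangle (HtpyCat.{u, v, w} A))
    (hT : T.rotate ∈ distTriangles A) : T ∈ distTriangles A := by
  obtain ⟨M, N, f, ⟨e⟩⟩ := hT
  obtain ⟨e'⟩ := exists_iso_rotate_coneTriangle f
  exact ⟨_, _, _, ⟨(rotate _).preimageIso (e ≪≫ e' ≪≫
    ((toHtpyCat A).mapTriangleRotateIso.app (coneTriangle (coneShiftDesc f))).symm)⟩⟩

/-- The cone of an identity is contractible, hence zero in `H(A)`. -/
lemma distTriangles_contractible (X : HtpyCat.{u, v, w} A) :
    contractibleTriangle X ∈ distTriangles A := by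
  obtain ⟨M, rfl⟩ := exists_eq_toHtpyCat_obj X
  have h : IsZero ((toHtpyCat A).obj (cone (𝟙 M))) := by
    rw [IsZero.iff_id_eq_zero, ← CategoryTheory.Functor.map_id, ← Functor.map_zero,
      toHtpyCat_map_eq_iff]
    obtain ⟨σ, hσ, e⟩ := isContractible_cone M
    exact ⟨σ, hσ, fun x => (sub_zero x).trans (e x)⟩
  refine ⟨M, M, 𝟙 M, ⟨Triangle.isoMk _ _ (Iso.refl _) (Iso.refl _)
    ((isZero_zero _).iso h) ?_ (h.eq_of_tgt _ _) ((isZero_zero _).eq_of_src _ _)⟩⟩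
  change 𝟙 _ ≫ 𝟙 _ = 𝟙 _ ≫ (toHtpyCat A).map (𝟙 M)
  rw [CategoryTheory.Functor.map_id]

/-- The triangulated structure on `H(A)`: the distinguished triangles are the triangles isomorphic
to the image of a standard triangle. -/
noncomputable instance : Pretriangulated (HtpyCat.{u, v, w} A) where
  distinguishedTriangles := distTriangles A
  isomorphic_distinguished _ hT _ e := distTriangles_of_iso hT e
  contractible_distinguished := distTriangles_contractible
  distinguished_cocone_triangle {X Y} f := by
    obtain ⟨M, rfl⟩ := exists_eq_toHtpyCat_obj X
    obtain ⟨N, rfl⟩ := exists_eq_toHtpyCat_obj Y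
    obtain ⟨f, rfl⟩ := (toHtpyCat A).map_surjective f
    exact ⟨_, _, _, _, _, f, ⟨Iso.refl _⟩⟩
  rotate_distinguished_triangle T := ⟨distTriangles_rotate T, distTriangles_of_rotate T⟩
  complete_distinguished_triangle_morphism := distTriangles_complete

/-- A map `f` need not be an inflation, so its standard triangle is replaced by the isomorphic
rotation of another one, whose first two morphisms do form a conflation. -/
lemma mem_distTriang_iff (T : Triangle (HtpyCat.{u, v, w} A)) :
    T ∈ distTriang (HtpyCat.{u, v, w} A) ↔ ∃ T' : Triangle (CycleCat.{u, v, w} A),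
      IsConflationTriangle T' ∧ Nonempty (T ≅ (toHtpyCat A).mapTriangle.obj T') := by
  constructor
  · rintro ⟨M, N, f, ⟨e⟩⟩
    obtain ⟨e'⟩ := exists_iso_rotate_coneTriangle f
    exact ⟨_, isConflationTriangle_rotate _, ⟨e ≪≫ e'⟩⟩
  · rintro ⟨T', hT', ⟨e⟩⟩
    exact distTriangles_of_iso (mem_distTriangles_of_isConflationTriangle hT') e

/-! ### The octahedral axiom -/

section Octahedron

variable {L M N : CycleCat.{u, v, w} A} (f : L ⟶ M) (g : M ⟶ N)

/-- The canonical morphism `C(f) ⟶ C(g ∘ f)`. -/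
noncomputable def coneCompLeft : cone f ⟶ cone (f ≫ g) :=
  coneMap f (f ≫ g) (𝟙 L) g 0 (zero_mem _) fun x => by
    simp

/-- The canonical morphism `C(g ∘ f) ⟶ C(g)`. -/
noncomputable def coneCompRight : cone (f ≫ g) ⟶ cone g :=
  coneMap (f ≫ g) g f (𝟙 N) 0 (zero_mem _) fun x => by
    simp

/-- The image of the triangle `C(f) ⟶ C(g ∘ f) ⟶ C(g) ⟶ C(f)[1]` is distinguished. -/
lemma coneComp_mem_distTriangles :
    (toHtpyCat A).mapTriangle.obj (Triangle.mk (coneCompLeft f g) (coneCompRight f g)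
      (coneSnd g ≫ (coneInl f)⟦(1 : ℤ)⟧')) ∈ distTriangles A := by
  have hl (x : M.mod.carrier × L.mod.carrier) :
      app (coneCompLeft f g) x = (app g x.1, x.2) :=
    Prod.ext (add_zero (app g x.1)) (zero_add x.2)
  have hr (x : N.mod.carrier × L.mod.carrier) :
      app (coneCompRight f g) x = (x.1, app f x.2) :=
    Prod.ext (add_zero x.1) (zero_add (app f x.2))
  -- In coordinates `φ` is `((n, l), (m, l')) ↦ (n, f l + m)`. The term `f l` comes from
  -- `coneCompRight`.
  let φ : cone (coneCompLeft f g) ⟶ cone g :=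
    twDesc (L := cone (f ≫ g)) (N := (cone f)⟦(1 : ℤ)⟧) (coneCompRight f g)
      (LinearMap.inr K N.mod.carrier M.mod.carrier ∘ₗ LinearMap.fst K M.mod.carrier L.mod.carrier)
      ⟨fun x a => Prod.ext (by
          change (0 : N.mod.carrier) = N.mod.act 0 a
          rw [map_zero, LinearMap.zero_apply]) rfl,
        fun k l h (x : M.mod.carrier × L.mod.carrier) hx => ⟨zero_mem _, by
          have hx₁ : x.1 ∈ M.mod.gr (k + 1) := hx.1
          rwa [show k + 1 = l + 1 by omega] at hx₁⟩⟩
      fun (x : M.mod.carrier × L.mod.carrier) => by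
        refine (cone_d g (0, x.1)).trans ?_
        refine Eq.trans ?_ (congrArg₂ (fun a b : N.mod.carrier × M.mod.carrier => a + b)
          ((congrArg (app (coneCompRight f g)) (hl x)).trans (hr _))
          (congrArg (LinearMap.inr K N.mod.carrier M.mod.carrier ∘ₗ
            LinearMap.fst K M.mod.carrier L.mod.carrier) ((shift_one_d (cone f).mod x).trans
              (congrArg Neg.neg (cone_d f x))))).symm
        refine Prod.ext ?_ ?_
        · change N.mod.d 0 + app g x.1 = app g x.1 + 0
          rw [map_zero, zero_add, add_zero]
        · change -M.mod.d x.1 = app f x.2 + -(M.mod.d x.1 + app f x.2)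
          abel
  -- In coordinates `ψ` is `(n, m) ↦ ((n, 0), (m, 0))`, a strict section of `φ`.
  let ψ : cone g ⟶ cone (coneCompLeft f g) :=
    twLift (L := cone (f ≫ g)) (N := (cone f)⟦(1 : ℤ)⟧)
      (LinearMap.inl K N.mod.carrier L.mod.carrier ∘ₗ LinearMap.fst K N.mod.carrier M.mod.carrier)
      ⟨fun x a => Prod.ext rfl (by
          change (0 : L.mod.carrier) = L.mod.act 0 a
          rw [map_zero, LinearMap.zero_apply]),
        fun k l h (x : N.mod.carrier × M.mod.carrier) hx => ⟨by
          have hx₁ : x.1 ∈ N.mod.gr k := hx.1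
          rwa [show k = l by omega] at hx₁, zero_mem _⟩⟩
      (coneSnd g ≫ (coneInl f)⟦(1 : ℤ)⟧') fun (x : N.mod.carrier × M.mod.carrier) => by
        refine (congrArg (LinearMap.inl K N.mod.carrier L.mod.carrier ∘ₗ
          LinearMap.fst K N.mod.carrier M.mod.carrier) (cone_d g x)).trans ?_
        refine Eq.trans ?_ (congrArg₂ (fun a b : N.mod.carrier × L.mod.carrier => a + b)
          (cone_d (f ≫ g) (x.1, 0)) (hl (x.2, 0))).symm
        refine Prod.ext ?_ ?_
        · change N.mod.d x.1 + app g x.2 = N.mod.d x.1 + app (f ≫ g) 0 + app g x.2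
          rw [map_zero, add_zero]
        · change (0 : L.mod.carrier) = -L.mod.d 0 + 0
          rw [map_zero, neg_zero, add_zero]
  refine mem_distTriangles_of_cone _ φ ψ ?_
    (CycleCat.ext fun (x : N.mod.carrier × M.mod.carrier) => ?_)
    (CycleCat.ext fun (x : N.mod.carrier × L.mod.carrier) =>
      add_zero (app (coneCompRight f g) x)) (CycleCat.ext fun x => rfl)
  · symm
    rw [toHtpyCat_map_eq_iff]
    let E : Type w := (N.mod.carrier × L.mod.carrier) × M.mod.carrier × L.mod.carrier
    -- The two copies of `L` cancel: the homotopy `((n, l), (m, l')) ↦ ((0, 0), (0, l))` inverts the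
    -- component `l' ↦ l'` of the differential. Its boundary is the identity minus the composite,
    -- which is why the sides were exchanged.
    let σ : E →ₗ[K] E := LinearMap.inr K (N.mod.carrier × L.mod.carrier)
      (M.mod.carrier × L.mod.carrier) ∘ₗ LinearMap.inr K M.mod.carrier L.mod.carrier ∘ₗ
        LinearMap.snd K N.mod.carrier L.mod.carrier ∘ₗ LinearMap.fst K _ _
    let D : E → E := (cone (coneCompLeft f g)).mod.d
    let P : E → E := app (φ ≫ ψ)
    have hD (x : E) : D x = ((N.mod.d x.1.1 + app g (app f x.1.2) + app g x.2.1,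
        -L.mod.d x.1.2 + x.2.2), (-(M.mod.d x.2.1 + app f x.2.2), - -L.mod.d x.2.2)) :=
      (cone_d (coneCompLeft f g) x).trans (Prod.ext
        (congrArg₂ (fun a b : N.mod.carrier × L.mod.carrier => a + b) (cone_d (f ≫ g) x.1) (hl x.2))
        (congrArg Neg.neg (cone_d f x.2)))
    have hP (x : E) : P x = ((x.1.1 + 0, 0), (app f x.1.2 + x.2.1, 0)) :=
      let F (y : N.mod.carrier × M.mod.carrier) : E := ((y.1 + 0, 0), (y.2 + x.2.1, 0))
      congrArg F (hr x.1)
    refine ⟨σ, ⟨fun x a => ?_, fun k l hkl x hx => ?_⟩, fun (x : E) => ?_⟩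
    · refine Prod.ext (Prod.ext ?_ ?_) (Prod.ext ?_ rfl)
      · change (0 : N.mod.carrier) = N.mod.act 0 a
        rw [map_zero, LinearMap.zero_apply]
      · change (0 : L.mod.carrier) = L.mod.act 0 a
        rw [map_zero, LinearMap.zero_apply]
      · change (0 : M.mod.carrier) = M.mod.act 0 a
        rw [map_zero, LinearMap.zero_apply]
    · have hx₁ : x.1.2 ∈ L.mod.gr (k + 1) := hx.1.2
      rw [show k + 1 = l + 1 + 1 by omega] at hx₁
      exact ⟨⟨zero_mem _, zero_mem _⟩, zero_mem _, hx₁⟩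
    · change x - P x = D (σ x) + σ (D x)
      rw [hP, hD, hD]
      refine Prod.ext (Prod.ext ?_ ?_) (Prod.ext ?_ ?_)
      · change x.1.1 - (x.1.1 + 0) = N.mod.d 0 + app g (app f 0) + app g 0 + 0
        simp only [map_zero, add_zero, sub_self]
      · change x.1.2 - 0 = -L.mod.d 0 + x.1.2 + 0
        simp only [map_zero, add_zero, sub_zero, neg_zero, zero_add]
      · change x.2.1 - (app f x.1.2 + x.2.1) = -(M.mod.d 0 + app f x.1.2) + 0
        simp only [map_zero, add_zero, zero_add, sub_add_cancel_right]
      · change x.2.2 - 0 = - -L.mod.d x.1.2 + (-L.mod.d x.1.2 + x.2.2)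
        rw [sub_zero, neg_neg, add_neg_cancel_left]
  · refine (congrArg (fun y : N.mod.carrier × M.mod.carrier => y + (0, x.2)) (hr (x.1, 0))).trans
      (Prod.ext (add_zero x.1) ?_)
    change app f 0 + x.2 = x.2
    rw [map_zero, zero_add]

end Octahedron

/-- It suffices to treat the standard triangles on lifts `f`, `g` and `f ≫ g`. The four
compatibilities come from strict identities in `C(A)`; the distinguished triangle of cones is
`coneComp_mem_distTriangles`. -/
instance : IsTriangulated (HtpyCat.{u, v, w} A) := IsTriangulated.mk' fun X Y Z u u' => by
  obtain ⟨L, rfl⟩ := exists_eq_toHtpyCat_obj X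
  obtain ⟨M, rfl⟩ := exists_eq_toHtpyCat_obj Y
  obtain ⟨N, rfl⟩ := exists_eq_toHtpyCat_obj Z
  obtain ⟨f, rfl⟩ := (toHtpyCat A).map_surjective u
  obtain ⟨g, rfl⟩ := (toHtpyCat A).map_surjective u'
  have h {M N : CycleCat.{u, v, w} A} (f : M ⟶ N) : Triangle.mk ((toHtpyCat A).map f)
      ((toHtpyCat A).map (coneInl f)) ((toHtpyCat A).map (coneSnd f) ≫
        ((toHtpyCat A).commShiftIso (1 : ℤ)).hom.app M) ∈ distTriang (HtpyCat.{u, v, w} A) :=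
    ⟨M, N, f, ⟨Iso.refl _⟩⟩
  have hfg := h (f ≫ g)
  rw [Functor.map_comp] at hfg
  refine ⟨_, _, _, _, _, _, (toHtpyCat A).map f, (toHtpyCat A).map g, Iso.refl _, Iso.refl _,
    Iso.refl _, (Category.comp_id _).trans (Category.id_comp _).symm,
    (Category.comp_id _).trans (Category.id_comp _).symm, _, _, h f, _, _, h g, _, _, hfg,
    ⟨(toHtpyCat A).map (coneCompLeft f g), (toHtpyCat A).map (coneCompRight f g),
      ?_, ?_, ?_, ?_, ?_⟩⟩
  · rw [← Functor.map_comp, ← Functor.map_comp]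
    exact congrArg _ coneInl_coneMap
  · rw [← Functor.map_comp_assoc, coneCompLeft, coneMap_coneSnd, CategoryTheory.Functor.map_id,
      Category.comp_id]
  · rw [← Functor.map_comp, coneCompRight, coneInl_coneMap, Category.id_comp]
  · rw [← Functor.map_comp_assoc, coneCompRight, coneMap_coneSnd, Functor.map_comp,
      Category.assoc, Category.assoc, Functor.commShiftIso_hom_naturality]
  · refine distTriangles_of_iso (coneComp_mem_distTriangles f g)
      (Triangle.isoMk _ _ (Iso.refl _) (Iso.refl _) (Iso.refl _)
        ((Category.comp_id _).trans (Category.id_comp _).symm)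
        ((Category.comp_id _).trans (Category.id_comp _).symm) ?_)
    refine Eq.trans ?_ (Category.id_comp _).symm
    change (((toHtpyCat A).map (coneSnd g) ≫ ((toHtpyCat A).commShiftIso (1 : ℤ)).hom.app M) ≫
      ((toHtpyCat A).map (coneInl f))⟦(1 : ℤ)⟧') ≫ (𝟙 ((toHtpyCat A).obj (cone f)))⟦(1 : ℤ)⟧' =
        (toHtpyCat A).map (coneSnd g ≫ (coneInl f)⟦(1 : ℤ)⟧') ≫
          ((toHtpyCat A).commShiftIso (1 : ℤ)).hom.app (cone f)
    rw [CategoryTheory.Functor.map_id, Category.assoc, Category.assoc]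
    refine (congrArg (_ ≫ _ ≫ ·) (Category.comp_id _)).trans ?_
    rw [← Functor.commShiftIso_hom_naturality, Functor.map_comp, Category.assoc]

/-! ### Direct sums and coproducts -/

/-- This reduces to single summands both `M A = M` and the fact that the homogeneous parts span a
direct sum. -/
lemma dfinsupp_submodule_eq_top {J : Type*} [DecidableEq J] {M : J → Type*}
    [∀ j, AddCommGroup (M j)] [∀ j, Module K (M j)] {S : Submodule K (Π₀ j, M j)}
    (h : ∀ j x, DFinsupp.single j x ∈ S) : S = ⊤ := by
  rw [eq_top_iff, ← DFinsupp.iSup_range_lsingle (R := K)]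
  refine iSup_le fun j => ?_
  rintro _ ⟨x, rfl⟩
  exact h j x

section DirectSum

open Classical in
/-- The direct sum of a family of dg modules. -/
noncomputable def directSum {J : Type w} (M : J → DGMod.{u, v, w} A) : DGMod.{u, v, w} A where
  carrier := Π₀ j, (M j).carrier
  act := LinearMap.mk₂ K
    (fun x a => DFinsupp.mapRange.linearMap (fun j => (M j).act.flip a) x)
    (fun _ _ _ => by rw [map_add]) (fun _ _ _ => by rw [map_smul])
    (fun x a b => DFinsupp.ext fun j => map_add ((M j).act (x j)) a b)
    (fun c x a => DFinsupp.ext fun j => map_smul ((M j).act (x j)) c a)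
  act_act x a b := DFinsupp.ext fun j => (M j).act_act (x j) a b
  unitary := dfinsupp_submodule_eq_top fun j x => by
    have hx : x ∈ Submodule.span K {y | ∃ x a, (M j).act x a = y} := by
      rw [(M j).unitary]
      trivial
    have h := Submodule.mem_map_of_mem 
      (f := DFinsupp.lsingle (R := K) (M := fun j => (M j).carrier) j) hx
    rw [Submodule.map_span] at h
    refine Submodule.span_mono ?_ h
    rintro _ ⟨_, ⟨x, a, rfl⟩, rfl⟩
    exact ⟨DFinsupp.single j x, a, DFinsupp.mapRange_single (f := fun j => (M j).act.flip a)
      (hf := fun j => map_zero _)⟩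
  gr k := ⨅ j, ((M j).gr k).comap (DFinsupp.lapply j)
  isInternal := by
    rw [DirectSum.isInternal_submodule_iff_iSupIndep_and_iSup_eq_top]
    constructor
    · intro i
      rw [Submodule.disjoint_def]
      intro x hx hx'
      -- Independence of the degrees is inherited from each summand by projecting to its coordinate.
      refine DFinsupp.ext fun j => ?_
      have h := Submodule.mem_map_of_mem (f := DFinsupp.lapply j) hx'
      simp only [Submodule.map_iSup] at h
      refine (Submodule.disjoint_def.1 ((M j).isInternal.submodule_iSupIndep i)) (x j)
        ((Submodule.mem_iInf _).1 hx j) ((?_ : _ ≤ ⨆ k, ⨆ (_ : k ≠ i), (M j).gr k) h)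
      refine iSup₂_mono fun k _ => ?_
      rintro _ ⟨z, hz, rfl⟩
      exact (Submodule.mem_iInf _).1 hz j
    · refine dfinsupp_submodule_eq_top fun j x => ?_
      refine induction_gr (M j).toGrMod (p := fun x =>
        (DFinsupp.single j x : Π₀ j, (M j).carrier) ∈ _) x
        (fun k x hx => Submodule.mem_iSup_of_mem k ((Submodule.mem_iInf _).2 fun i => ?_)) ?_
        (fun x y hx hy => ?_)
      · change (DFinsupp.single j x : Π₀ j, (M j).carrier) i ∈ (M i).gr k
        by_cases h : j = i
        · subst h
          rwa [DFinsupp.single_eq_same]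
        · rw [DFinsupp.single_eq_of_ne (Ne.symm h)]
          exact zero_mem _
      · rw [DFinsupp.single_zero]
        exact zero_mem _
      · rw [DFinsupp.single_add]
        exact add_mem hx hy
  act_mem hx ha := (Submodule.mem_iInf _).2 fun j =>
    (M j).act_mem ((Submodule.mem_iInf _).1 hx j) ha
  d := DFinsupp.mapRange.linearMap fun j => (M j).d
  d_mem hx := (Submodule.mem_iInf _).2 fun j => (M j).d_mem ((Submodule.mem_iInf _).1 hx j)
  d_d x := DFinsupp.ext fun j => (M j).d_d (x j)
  leibniz a hx := DFinsupp.ext fun j => (M j).leibniz a ((Submodule.mem_iInf _).1 hx j)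

lemma mem_gr_directSum {J : Type w} {M : J → DGMod.{u, v, w} A} {k : ℤ}
    (x : Π₀ j, (M j).carrier) : x ∈ (directSum M).gr k ↔ ∀ j, x j ∈ (M j).gr k :=
  Submodule.mem_iInf (p := fun j => ((M j).gr k).comap
    (DFinsupp.lapply (R := K) (M := fun j => (M j).carrier) j))

variable {J : Type w} (M : J → CycleCat.{u, v, w} A) {N : CycleCat.{u, v, w} A}

/-- The direct sum as an object of `C(A)`. -/
noncomputable abbrev sumObj : CycleCat.{u, v, w} A := .of K (directSum fun j => (M j).mod)

open Classical in
/-- The linear map on the direct sum given by a family of linear maps. -/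
noncomputable def sumLin (F : ∀ j, (M j).mod.carrier →ₗ[K] N.mod.carrier) :
    (sumObj M).mod.carrier →ₗ[K] N.mod.carrier :=
  DFinsupp.lsum (M := fun j => (M j).mod.carrier) ℕ F

open Classical in
/-- The inclusion of a direct summand. -/
noncomputable def sumInj (j : J) : M j ⟶ sumObj M :=
  CycleCat.mk (M := (M j).mod) (N := (sumObj M).mod)
    (DFinsupp.lsingle (M := fun j => (M j).mod.carrier) j)
    ⟨fun x a => (DFinsupp.mapRange_single (f := fun j => (M j).mod.act.flip a)
        (hf := fun j => map_zero _)).symm, fun k l h x hx => (mem_gr_directSum _).2 fun i => by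
      obtain rfl : k = l := by omega
      change (DFinsupp.single j x : Π₀ j, (M j).mod.carrier) i ∈ (M i).mod.gr k
      by_cases h : j = i
      · subst h
        rwa [DFinsupp.single_eq_same]
      · rw [DFinsupp.single_eq_of_ne (Ne.symm h)]
        exact zero_mem _⟩
    fun x => (DFinsupp.mapRange_single (f := fun j => (M j).mod.d)
      (hf := fun j => map_zero _)).symm

variable {M}

lemma sumLin_inj (F : ∀ j, (M j).mod.carrier →ₗ[K] N.mod.carrier) (j : J)
    (x : (M j).mod.carrier) : sumLin M F (app (sumInj M j) x) = F j x := by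
  classical
  exact DFinsupp.lsum_single (M := fun j => (M j).mod.carrier) ℕ F j x

lemma sum_hom_ext {P : Type*} [AddCommGroup P] [Module K P]
    {f g : (sumObj M).mod.carrier →ₗ[K] P}
    (h : ∀ j x, f (app (sumInj M j) x) = g (app (sumInj M j) x)) : f = g := by
  classical
  exact DFinsupp.lhom_ext (M := fun j => (M j).mod.carrier) h

lemma sumLin_mem {n : ℤ} {F : ∀ j, (M j).mod.carrier →ₗ[K] N.mod.carrier}
    (hF : ∀ j, F j ∈ (M j).mod.toGrMod.HOM N.mod.toGrMod n) :
    sumLin M F ∈ (sumObj M).mod.toGrMod.HOM N.mod.toGrMod n := by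
  classical
  refine ⟨fun x a => ?_, fun k l h x hx => ?_⟩
  · have e : sumLin M F ∘ₗ (sumObj M).mod.act.flip a = N.mod.act.flip a ∘ₗ sumLin M F :=
      sum_hom_ext fun j x => by
        change sumLin M F ((sumObj M).mod.act (app (sumInj M j) x) a) =
          N.mod.act (sumLin M F (app (sumInj M j) x)) a
        rw [← (app_mem (sumInj M j)).1, sumLin_inj, sumLin_inj, (hF j).1]
    exact LinearMap.congr_fun e x
  · exact Submodule.dfinsuppSumAddHom_mem (β := fun j => (M j).mod.carrier) (N.mod.gr l) x
      (fun j => (F j).toAddMonoidHom) fun j _ => (hF j).2 k l h _ ((mem_gr_directSum _).1 hx j)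

/-- The morphism from the direct sum given by a family of morphisms. -/
noncomputable def sumDesc (f : ∀ j, M j ⟶ N) : sumObj M ⟶ N :=
  CycleCat.mk (M := (sumObj M).mod) (N := N.mod) (sumLin M fun j => app (f j))
    (sumLin_mem fun j => app_mem (f j)) fun x => by
      have e : (sumLin M fun j => app (f j)) ∘ₗ (sumObj M).mod.d =
          N.mod.d ∘ₗ sumLin M fun j => app (f j) :=
        sum_hom_ext fun j x => by
          change sumLin M (fun j => app (f j)) ((sumObj M).mod.d (app (sumInj M j) x)) =
            N.mod.d (sumLin M (fun j => app (f j)) (app (sumInj M j) x))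
          rw [← app_d, sumLin_inj, sumLin_inj, app_d]
      exact LinearMap.congr_fun e x

lemma sumInj_desc (f : ∀ j, M j ⟶ N) (j : J) : sumInj M j ≫ sumDesc f = f j :=
  CycleCat.ext fun x => sumLin_inj (fun j => app (f j)) j x

/-- Homotopies on the summands define a homotopy on the direct sum. -/
lemma toHtpyCat_map_sum_ext {f g : sumObj M ⟶ N}
    (h : ∀ j, (toHtpyCat A).map (sumInj M j ≫ f) = (toHtpyCat A).map (sumInj M j ≫ g)) :
    (toHtpyCat A).map f = (toHtpyCat A).map g := by
  simp only [toHtpyCat_map_eq_iff] at h ⊢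
  -- One homotopy is chosen on each summand. No finiteness is needed, since any family of maps
  -- extends to the direct sum.
  choose σ hσ e using h
  refine ⟨sumLin M σ, sumLin_mem hσ, LinearMap.congr_fun (f := app f - app g)
    (g := N.mod.d ∘ₗ sumLin M σ + sumLin M σ ∘ₗ (sumObj M).mod.d) (sum_hom_ext fun j x => ?_)⟩
  change app f (app (sumInj M j) x) - app g (app (sumInj M j) x) =
    N.mod.d (sumLin M σ (app (sumInj M j) x)) + sumLin M σ ((sumObj M).mod.d (app (sumInj M j) x))
  rw [← app_d, sumLin_inj, sumLin_inj, ← e]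
  rfl

end DirectSum

/-- Factorizations come from the direct sum in `C(A)` applied to lifts of the given morphisms.
Uniqueness holds up to homotopy, by `toHtpyCat_map_sum_ext`. -/
lemma hasCoproducts_htpyCat : HasCoproducts.{w} (HtpyCat.{u, v, w} A) := fun J => by
  have h (X : J → HtpyCat.{u, v, w} A) : HasCoproduct X := by
    obtain ⟨M, rfl⟩ : ∃ M : J → CycleCat.{u, v, w} A, X = fun j => (toHtpyCat A).obj (M j) :=
      ⟨fun j => (X j).as, rfl⟩
    refine ⟨⟨⟨Cofan.mk ((toHtpyCat A).obj (sumObj M)) fun j => (toHtpyCat A).map (sumInj M j),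
      Cofan.IsColimit.mk _ (fun s => ?_) (fun s j => ?_) fun s m hm => ?_⟩⟩⟩
    · exact (toHtpyCat A).map (sumDesc fun j => (toHtpyCat A).preimage (Y := s.pt.as) (s.inj j))
    · refine ((toHtpyCat A).map_comp _ _).symm.trans ?_
      rw [sumInj_desc]
      exact (toHtpyCat A).map_preimage (Y := s.pt.as) (s.inj j)
    · obtain ⟨m, rfl⟩ := (toHtpyCat A).map_surjective (Y := s.pt.as) m
      refine toHtpyCat_map_sum_ext fun j => ?_
      rw [sumInj_desc, Functor.map_comp]
      exact (hm j).trans ((toHtpyCat A).map_preimage (Y := s.pt.as) (s.inj j)).symm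
  exact ⟨fun F => hasColimit_of_iso Discrete.natIsoFunctor⟩

end DGMod

theorem mainTheorem9 {K : Type u} [CommRing K] (A : DGAlg.{u, v} K) :
    -- `C(A)` with the semi-split conflations is a Frobenius exact category
    IsFrobeniusExact (DGMod.semiSplit.{u, v, w} A) ∧
    -- the shift is the cosyzygy functor, by the conflations `M ⟶ C(1_M) ⟶ M[1]`
    (∀ M : DGMod.CycleCat.{u, v, w} A,
      IsRelInjective (DGMod.semiSplit A) (DGMod.cone (𝟙 M)) ∧
      DGMod.semiSplit A (ShortComplex.mk (DGMod.coneInl (𝟙 M)) (DGMod.coneSnd (𝟙 M))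
        (DGMod.coneInl_coneSnd (𝟙 M)))) ∧
    -- `H(A)` has arbitrary set-indexed coproducts
    HasCoproducts.{w} (DGMod.HtpyCat.{u, v, w} A) ∧
    -- `H(A)`, with the suspension induced by `?[1]`, is a (`K`-linear) triangulated category whose
    -- distinguished triangles are, up to isomorphism, the images of the conflations of `C(A)`
    (∀ n : ℤ, (shiftFunctor (DGMod.HtpyCat.{u, v, w} A) n).Linear K) ∧
    (∃ _ : Pretriangulated (DGMod.HtpyCat.{u, v, w} A),
      IsTriangulated (DGMod.HtpyCat.{u, v, w} A) ∧
      ∀ T : Pretriangulated.Triangle (DGMod.HtpyCat.{u, v, w} A),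
        T ∈ Pretriangulated.distinguishedTriangles ↔
          ∃ T' : Pretriangulated.Triangle (DGMod.CycleCat.{u, v, w} A),
            DGMod.IsConflationTriangle T' ∧
            Nonempty (T ≅ (DGMod.toHtpyCat A).mapTriangle.obj T')) ∧
    -- `H(A)` is equivalent to `H⁰(Dg-A)`, compatibly with the projections from `C(A) = Z⁰(Dg-A)`
    ∃ e : DGMod.HtpyCat.{u, v, w} A ≌ DGCategory.ZeroHomology K (DGMod.{u, v, w} A),
      e.functor.Additive ∧ e.functor.Linear K ∧
      Nonempty (DGMod.toHtpyCat A ⋙ e.functor ≅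
        DGCategory.toZeroHomology K (DGMod.{u, v, w} A)) := by
  refine ⟨DGMod.isFrobeniusExact_semiSplit A, fun M =>
    ⟨(DGMod.isContractible_cone M).isRelInjective, (DGMod.coneSplit (𝟙 M)).semiSplit⟩,
    DGMod.hasCoproducts_htpyCat, fun n => inferInstance, ⟨inferInstance, inferInstance,
    DGMod.mem_distTriang_iff⟩, (DGMod.htpyToZeroHomology A).asEquivalence, ?_, ?_,
    ⟨DGMod.toHtpyCatCompIso A⟩⟩
  · exact inferInstanceAs (DGMod.htpyToZeroHomology A).Additive
  · exact inferInstanceAs ((DGMod.htpyToZeroHomology A).Linear K)
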